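/- Let $G,m,\lambda>0$ and $\Lambda\in\mathbb R$ (Newton constant, mass of a conformally coupled scalar field, length scale of the Hadamard parametrix, cosmological constant), and set $H_c:=\sqrt{180\pi/G}$. Let $\tau_0\in\mathbb R$, $a_0>0$ and $|H_0|<H_c$. For $\tau_1>\tau_0$ let $C[\tau_0,\tau_1]$ be the space of real continuous functions on $[\tau_0,\tau_1]$ with the uniform norm. For $H\in C[\tau_0,\tau_1]$ with $a_0\int_{\tau_0}^{\tau}H\,d\eta<1$ for all $\tau\in[\tau_0,\tau_1]$, define in conformal time $\tau$ the scale factor of a flat FLRW spacetime and the potential $$a(\tau)=a_0\Big(1-a_0\int_{\tau_0}^{\tau}H(\eta)\,d\eta\Big)^{-1},\qquad V(\tau)=m^2\big(a(\tau)^2-a_0^2\big),$$ and, for $\vec k\in\mathbb R^3$, $k=|\vec k|$, $k_0=\sqrt{k^2+a_0^2m^2}$, the modes $\chi_k=\sum_{n\ge0}\chi_k^{(n)}$ of the adiabatic state of order zero, $$\chi_k^{(0)}(\tau)=\frac{e^{ik_0\tau}}{\sqrt{2k_0}},\qquad \chi_k^{(n)}(\tau)=\int_{\tau_0}^{\tau}\frac{\sin(k_0(\eta-\tau))}{k_0}\,V(\eta)\,\chi_k^{(n-1)}(\eta)\,d\eta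 .$$ The renormalized Wick square in this state is $$w_H(\tau)=\frac{1}{(2\pi)^3a^2}\int_{\mathbb R^3}\Big(|\chi_k|^2-\frac1{2k_0}+\frac{V}{4k_0^3}\Big)d\vec k+\frac{m^2}{(4\pi)^2}\Big(\frac12-\Big(\frac{a_0}{a}\Big)^2+2\ln\frac{a_0}{a}+2\ln\frac{e^{\gamma}m\lambda}{\sqrt2}\Big),$$ where $\gamma$ is Euler's constant and $a,\chi_k,V$ are evaluated at $\tau$. Put $$f(H)=\frac{a}{H_c^2-H^2}\Big(H^4-2H_c^2H^2-\tfrac{15}{2}m^4+240\pi^2\big(m^2w_H+4\Lambda\big)\Big).$$ Then there are $\tau_1>\tau_0$ and a closed subset $U\subset C[\tau_0,\tau_1]$, containing a closed ball of positive radius around the constant function $H_0$ and contained in $$\Big\{H\in C[\tau_0,\tau_1]:\ \|H\|_\infty<\min\{a_0^{-1}(\tau_1-\tau_0)^{-1},H_c\}\Big\},$$ such that for every $H\in U$ the function $f(H)$ is well defined and continuous on $[\tau_0,\tau_1]$ (that is, $a_0\int_{\tau_0}^{\tau}H\,d\eta<1$ and $|H(\tau)|<H_c$ for all $\tau\in[\tau_0,\tau_1]$,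 and the series $\sum_n\chi_k^{(n)}(\tau)$ and the integral over $\vec k$ converge absolutely), and there is exactly one $H\in U$ that solves the semiclassical Friedmann equation $$H(\tau)=H_0+\int_{\tau_0}^{\tau}f(H)(\eta)\,d\eta\qquad\text{for all }\tau\in[\tau_0,\tau_1].$$ -/

import Mathlib

open MeasureTheory

noncomputable section

namespace SemiclassicalFriedmann

/-- The critical value of the Hubble function, `H_c² = 180 π / G`. -/
def criticalHubble (G : ℝ) : ℝ := Real.sqrt (180 * Real.pi / G)

/-- The scale factor in conformal time with `a(τ₀) = a₀` determined by the Hubble function `H`,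
that is, the solution of `a' = a² H`. -/
def scaleFactor (a₀ τ₀ : ℝ) (H : ℝ → ℝ) (τ : ℝ) : ℝ :=
  a₀ * (1 - a₀ * ∫ η in τ₀..τ, H η)⁻¹

/-! ### The state of adiabatic order zero on the flat FLRW spacetime with scale factor `a` -/

/-- The initial frequency `k₀ = (k² + a(τ₀)² m²)^{1/2}`. -/
def initialFrequency (m τ₀ : ℝ) (a : ℝ → ℝ) (k : ℝ) : ℝ :=
  Real.sqrt (k ^ 2 + a τ₀ ^ 2 * m ^ 2)

/-- The potential `V(τ) = m² (a(τ)² - a(τ₀)²)`. -/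
def potential (m τ₀ : ℝ) (a : ℝ → ℝ) (τ : ℝ) : ℝ :=
  m ^ 2 * (a τ ^ 2 - a τ₀ ^ 2)

/-- The terms `χ_k^{(n)}(τ)` of the perturbative expansion of the mode `χ_k(τ)`. -/
def modeTerm (m τ₀ : ℝ) (a : ℝ → ℝ) (k : ℝ) : ℕ → ℝ → ℂ
  | 0, τ =>
      ((1 / Real.sqrt (2 * initialFrequency m τ₀ a k) : ℝ) : ℂ) *
        Complex.exp (Complex.I * ((initialFrequency m τ₀ a k * τ : ℝ) : ℂ))
  | n + 1, τ =>
      ∫ η in τ₀..τ,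
        ((Real.sin (initialFrequency m τ₀ a k * (η - τ)) / initialFrequency m τ₀ a k *
          potential m τ₀ a η : ℝ) : ℂ) * modeTerm m τ₀ a k n η

/-- The mode `χ_k(τ) = ∑ₙ χ_k^{(n)}(τ)` of the state. -/
def mode (m τ₀ : ℝ) (a : ℝ → ℝ) (k τ : ℝ) : ℂ :=
  ∑' n, modeTerm m τ₀ a k n τ

/-- The regularized mode density `|χ_k|² - 1/(2 k₀) + V/(4 k₀³)`. -/
def modeDensity (m τ₀ : ℝ) (a : ℝ → ℝ) (k τ : ℝ) : ℝ :=
  ‖mode m τ₀ a k τ‖ ^ 2 - 1 / (2 * initialFrequency m τ₀ a k) +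
    potential m τ₀ a τ / (4 * initialFrequency m τ₀ a k ^ 3)

/-- The renormalized Wick square at conformal time `τ`; `ℓ` is the length scale `λ` of the
Hadamard parametrix. -/
def wickSquare (m ℓ τ₀ : ℝ) (a : ℝ → ℝ) (τ : ℝ) : ℝ :=
  1 / ((2 * Real.pi) ^ 3 * a τ ^ 2) *
      (∫ k : EuclideanSpace ℝ (Fin 3), modeDensity m τ₀ a ‖k‖ τ) +
    m ^ 2 / (4 * Real.pi) ^ 2 *
      (1 / 2 - (a τ₀ / a τ) ^ 2 + 2 * Real.log (a τ₀ / a τ) +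
        2 * Real.log (Real.exp Real.eulerMascheroniConstant * m * ℓ / Real.sqrt 2))

/-- All mode sums and the momentum integral in the Wick square at time `τ` converge
(absolutely), so that `wickSquare` is a genuine finite number. -/
def WickSquareFinite (m τ₀ : ℝ) (a : ℝ → ℝ) (τ : ℝ) : Prop :=
  (∀ k : ℝ, Summable fun n => modeTerm m τ₀ a k n τ) ∧
    Integrable fun k : EuclideanSpace ℝ (Fin 3) => modeDensity m τ₀ a ‖k‖ τ

/-! ### The semiclassical Friedmann equation -/

/-- The functional `f(H)(τ)`, the integrand of the semiclassical Friedmann equation. -/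
def friedmannIntegrand (G Λ m ℓ a₀ τ₀ : ℝ) (H : ℝ → ℝ) (τ : ℝ) : ℝ :=
  scaleFactor a₀ τ₀ H τ / (criticalHubble G ^ 2 - H τ ^ 2) *
    (H τ ^ 4 - 2 * criticalHubble G ^ 2 * H τ ^ 2 - 15 / 2 * m ^ 4 +
      240 * Real.pi ^ 2 * (m ^ 2 * wickSquare m ℓ τ₀ (scaleFactor a₀ τ₀ H) τ + 4 * Λ))

/-- `H ∈ C[τ₀, τ₁]` solves `H(τ) = H₀ + ∫_{τ₀}^τ f(H)(η) dη` on `[τ₀, τ₁]`. The values of `f(H)`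
on `[τ₀, τ₁]` involve only the values of `H` there, so the extension of `H` is immaterial. -/
def IsSolution (G Λ m ℓ a₀ H₀ : ℝ) {τ₀ τ₁ : ℝ} (h : τ₀ < τ₁) (H : C(Set.Icc τ₀ τ₁, ℝ)) : Prop :=
  ∀ τ : Set.Icc τ₀ τ₁,
    H τ = H₀ + ∫ η in τ₀..(τ : ℝ),
      friedmannIntegrand G Λ m ℓ a₀ τ₀ (Set.IccExtend h.le H) η

/-- The right-hand side of the integral equation is well defined at `H`: the scale factor is
regular, `|H|` stays below the critical value, the Wick square is finite at all times, and `f(H)` is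
continuous on `[τ₀, τ₁]`. -/
def IsAdmissible (G Λ m ℓ a₀ : ℝ) {τ₀ τ₁ : ℝ} (h : τ₀ < τ₁) (H : C(Set.Icc τ₀ τ₁, ℝ)) : Prop :=
  (∀ τ : Set.Icc τ₀ τ₁, a₀ * (∫ η in τ₀..(τ : ℝ), Set.IccExtend h.le H η) < 1) ∧
  (∀ τ : Set.Icc τ₀ τ₁, |H τ| < criticalHubble G) ∧
  (∀ τ : Set.Icc τ₀ τ₁,
    WickSquareFinite m τ₀ (scaleFactor a₀ τ₀ (Set.IccExtend h.le H)) τ) ∧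
  ContinuousOn (friedmannIntegrand G Λ m ℓ a₀ τ₀ (Set.IccExtend h.le H)) (Set.Icc τ₀ τ₁)

/-- The open set `𝒰[τ₀, τ₁]` of Hubble functions with
`‖H‖ < min {a₀⁻¹ (τ₁ - τ₀)⁻¹, H_c}` in the uniform norm. -/
def candidates (G a₀ τ₀ τ₁ : ℝ) : Set C(Set.Icc τ₀ τ₁, ℝ) :=
  {H | ‖H‖ < min (a₀⁻¹ * (τ₁ - τ₀)⁻¹) (criticalHubble G)}

end SemiclassicalFriedmann

end

namespace SemiclassicalFriedmann

/-! ### A Plancherel bound for compactly supported functions -/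

/-! The solution is a Picard fixed point in a closed ball of `C[τ₀, τ₀ + T]`, with `T` small. What
must be shown is that `f` is bounded and Lipschitz on that ball, with constants independent of `T`.
Now `f(H)(τ)` is a smooth function of `a₀ / a`, of `H` and of the momentum integral `J` of the
regularized mode density, and these stay in a compact box away from the singularities
(`friedmannRate`, `exists_constants`). So everything rests on `J`.

Since `a' = a² H`, the potential has derivative `v = 2 m² a³ H`. This contains no derivative of `H`,
so `v` is Lipschitz in `H` for the uniform norm. For a mode of frequency `κ`, conservation of energy
turns the oscillator equation into a Volterra equation for `u = |χ|² - 1/(2κ)`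
(`volterra_of_oscillator`): `u + V/(4κ³) = (4κ³)⁻¹ ∫ cos(2κ(τ - η)) v dη + ∫ sin(2κ(τ - η))/(2κ) ·
memory dη`. The memory integral is `O(κ⁻⁴)`, hence integrable over `ℝ³`, and so is its variation
with `v` (`abs_pertDensity_sub_le`).

The cosine term carries only `κ⁻³`, which diverges logarithmically in three dimensions, and `v` is
merely continuous, so no integration by parts is available. Plancherel replaces it: the cosine
integral is square integrable in `κ`, with norm controlled by `sup |v|`, and Young's inequality
makes the term integrable even against the extra weight `κ^(1/4)`
(`exists_integral_cosIntegral_le`). Linearity of this term in `v` gives the Lipschitz bound on `J`;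
the spare weight gives tails uniform in `τ`, hence continuity of `J` in time
(`exists_densityIntegral_bounds`). -/

theorem lintegral_eq_lintegral_tsum_translate {p : ℝ} (hp : 0 < p) {f : ℝ → ENNReal}
    (hf : Measurable f) :
    ∫⁻ x, f x = ∫⁻ x in Set.Ioc 0 p, ∑' n : ℤ, f (x + n * p) := by
  rw [lintegral_tsum fun n => by fun_prop, ← setLIntegral_univ,
    ← iUnion_Ioc_add_zsmul hp 0, lintegral_iUnion (fun _ => measurableSet_Ioc)
      (Set.pairwise_disjoint_Ioc_add_zsmul 0 p)]
  congr 1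
  ext n
  have hmp : MeasurePreserving (fun x : ℝ => x + n * p) volume volume :=
    measurePreserving_add_right volume _
  rw [← hmp.setLIntegral_comp_preimage measurableSet_Ioc hf]
  congr 2
  ext x
  simp only [Set.mem_preimage, Set.mem_Ioc, zsmul_eq_mul]
  push_cast
  constructor <;> rintro ⟨h1, h2⟩ <;> constructor <;> linarith

/-- The Fourier integral at angular frequency `2 ω`. -/
noncomputable def fourierOn (g : ℝ → ℝ) (a b ω : ℝ) : ℂ :=
  ∫ x in a..b, Complex.exp (-2 * ω * x * Complex.I) * (g x : ℂ)

theorem continuous_fourierOn {g : ℝ → ℝ} (hg : Continuous g) (a b : ℝ) :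
    Continuous (fourierOn g a b) := by
  unfold fourierOn
  refine intervalIntegral.continuous_parametric_intervalIntegral_of_continuous ?_ continuous_const
  simp only [Function.uncurry_def]
  fun_prop

/-- Parseval on `[a, b]` for `exp(-2iθx) g(x)`. The lattice spacing is `π / (b - a)`, not `2π / (b -
a)`, because `fourierOn` uses angular frequency `2ω`. The sum does not depend on `θ`. -/
theorem hasSum_sq_fourierOn {g : ℝ → ℝ} (hg : Continuous g) {a b : ℝ} (hab : a < b) (θ : ℝ) :
    HasSum (fun n : ℤ => ‖fourierOn g a b (θ + n * (Real.pi / (b - a)))‖ ^ 2)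
      ((b - a) * ∫ x in a..b, g x ^ 2) := by
  have hb : (b - a) ≠ 0 := (sub_pos.2 hab).ne'
  have hcont : Continuous fun x : ℝ => Complex.exp (-2 * θ * x * Complex.I) * (g x : ℂ) := by
    fun_prop
  have hmem : MemLp (fun x : ℝ => Complex.exp (-2 * θ * x * Complex.I) * (g x : ℂ)) 2
      (volume.restrict (Set.Ioc a b)) := by
    rw [memLp_two_iff_integrable_sq_norm hcont.aestronglyMeasurable]
    exact (hcont.norm.pow 2).integrableOn_Ioc
  have hnorm : ∀ x : ℝ, ‖Complex.exp (-2 * θ * x * Complex.I) * (g x : ℂ)‖ ^ 2 = g x ^ 2 := by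
    intro x
    have : (-2 * θ * x * Complex.I : ℂ) = ((-2 * θ * x : ℝ) : ℂ) * Complex.I := by push_cast; ring
    rw [norm_mul, this, Complex.norm_exp_ofReal_mul_I, one_mul, Complex.norm_real,
      Real.norm_eq_abs, sq_abs]
  have h := (hasSum_sq_fourierCoeffOn hab hmem).mul_left ((b - a) ^ 2)
  simp only [hnorm] at h
  have hval : (b - a) * ∫ x in a..b, g x ^ 2 =
      (b - a) ^ 2 * (b - a)⁻¹ • ∫ x in a..b, g x ^ 2 := by
    rw [smul_eq_mul]; field_simp
  rw [hval]
  refine h.congr_fun fun n => ?_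
  rw [fourierCoeffOn_eq_integral, norm_smul, mul_pow, ← mul_assoc]
  have : (b - a) ^ 2 * ‖1 / (b - a)‖ ^ 2 = 1 := by
    rw [Real.norm_eq_abs, sq_abs]; field_simp
  rw [this, one_mul]
  congr 2
  unfold fourierOn
  congr 1
  ext x
  rw [fourier_coe_apply, smul_eq_mul, ← mul_assoc, ← Complex.exp_add]
  congr 2
  have : ((b - a : ℝ) : ℂ) ≠ 0 := by exact_mod_cast hb
  push_cast at this ⊢
  field_simp
  ring

/-- Plancherel from Parseval: fold the line onto one lattice cell of length `π / (b - a)`, where the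
sum over translates is the constant `(b - a) ∫ g²`. -/
theorem lintegral_sq_fourierOn {g : ℝ → ℝ} (hg : Continuous g) {a b : ℝ} (hab : a < b) :
    ∫⁻ ω, ENNReal.ofReal (‖fourierOn g a b ω‖ ^ 2) =
      ENNReal.ofReal (Real.pi * ∫ x in a..b, g x ^ 2) := by
  have hb : 0 < b - a := sub_pos.2 hab
  have hm := (continuous_fourierOn hg a b).measurable
  rw [lintegral_eq_lintegral_tsum_translate (div_pos Real.pi_pos hb) (by fun_prop)]
  have : ∀ θ : ℝ, ∑' n : ℤ, ENNReal.ofReal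
      (‖fourierOn g a b (θ + n * (Real.pi / (b - a)))‖ ^ 2) =
        ENNReal.ofReal ((b - a) * ∫ x in a..b, g x ^ 2) := by
    intro θ
    have h := hasSum_sq_fourierOn hg hab θ
    rw [← ENNReal.ofReal_tsum_of_nonneg (fun _ => by positivity) h.summable, h.tsum_eq]
  simp only [this]
  rw [setLIntegral_const, Real.volume_Ioc, sub_zero, ← ENNReal.ofReal_mul]
  · congr 1
    field_simp
  · exact mul_nonneg hb.le (intervalIntegral.integral_nonneg hab.le fun _ _ => sq_nonneg _)

/-- The oscillating integral `∫ cos (2 ω (τ - η)) g(η) dη`. -/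
noncomputable def cosIntegral (g : ℝ → ℝ) (τ₀ τ ω : ℝ) : ℝ :=
  ∫ η in τ₀..τ, Real.cos (2 * ω * (τ - η)) * g η

theorem continuous_cosIntegral {g : ℝ → ℝ} (hg : Continuous g) (τ₀ τ : ℝ) :
    Continuous (cosIntegral g τ₀ τ) := by
  unfold cosIntegral
  refine intervalIntegral.continuous_parametric_intervalIntegral_of_continuous ?_ continuous_const
  simp only [Function.uncurry_def]
  fun_prop

theorem cosIntegral_eq_re {g : ℝ → ℝ} (hg : Continuous g) (τ₀ τ ω : ℝ) :
    cosIntegral g τ₀ τ ω =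
      (Complex.exp ((2 * ω * τ : ℝ) * Complex.I) * fourierOn g τ₀ τ ω).re := by
  unfold cosIntegral fourierOn
  rw [← intervalIntegral.integral_const_mul, ← Complex.reCLM_apply,
    ← ContinuousLinearMap.intervalIntegral_comp_comm _
      (Continuous.intervalIntegrable (by fun_prop) _ _)]
  congr 1
  ext η
  rw [← mul_assoc, ← Complex.exp_add, Complex.reCLM_apply, Complex.re_mul_ofReal]
  have : ((2 * ω * τ : ℝ) * Complex.I + -2 * ω * η * Complex.I : ℂ) =
      ((2 * ω * (τ - η) : ℝ) : ℂ) * Complex.I := by push_cast; ring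
  rw [this, Complex.exp_ofReal_mul_I_re]

theorem lintegral_sq_cosIntegral_le {g : ℝ → ℝ} (hg : Continuous g) {M : ℝ} (hM : ∀ x, |g x| ≤ M)
    {τ₀ τ : ℝ} (hτ : τ₀ ≤ τ) :
    ∫⁻ ω, ENNReal.ofReal (cosIntegral g τ₀ τ ω ^ 2) ≤
      ENNReal.ofReal (Real.pi * (M ^ 2 * (τ - τ₀))) := by
  rcases hτ.eq_or_lt with rfl | h
  · simp [cosIntegral]
  calc _ ≤ ∫⁻ ω, ENNReal.ofReal (‖fourierOn g τ₀ τ ω‖ ^ 2) := by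
        refine lintegral_mono fun ω => ENNReal.ofReal_le_ofReal ?_
        rw [cosIntegral_eq_re hg, ← sq_abs]
        refine pow_le_pow_left₀ (abs_nonneg _) ((Complex.abs_re_le_norm _).trans ?_) 2
        rw [norm_mul, Complex.norm_exp_ofReal_mul_I, one_mul]
    _ = _ := lintegral_sq_fourierOn hg h
    _ ≤ _ := by
        refine ENNReal.ofReal_le_ofReal (mul_le_mul_of_nonneg_left ?_ Real.pi_pos.le)
        have : ∫ x in τ₀..τ, g x ^ 2 ≤ ∫ _ in τ₀..τ, M ^ 2 := by
          refine intervalIntegral.integral_mono_on hτ (Continuous.intervalIntegrable (by fun_prop) _ _)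
            (by simp) fun x _ => ?_
          rw [← sq_abs]
          exact pow_le_pow_left₀ (abs_nonneg _) (hM x) 2
        simpa [mul_comm] using this

/-! ### Momentum integrals -/

/-- Momentum space `ℝ³`. -/
abbrev Momentum : Type := EuclideanSpace ℝ (Fin 3)

/-- The frequency `√(r² + c²)`. -/
noncomputable def freq (c r : ℝ) : ℝ := Real.sqrt (r ^ 2 + c ^ 2)

theorem continuous_freq (c : ℝ) : Continuous (freq c) := by unfold freq; fun_prop

theorem sq_freq (c r : ℝ) : freq c r ^ 2 = r ^ 2 + c ^ 2 := Real.sq_sqrt (by positivity)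

theorem le_freq {c : ℝ} (r : ℝ) : c ≤ freq c r :=
  Real.le_sqrt_of_sq_le (by nlinarith [sq_nonneg r])

theorem freq_pos {c : ℝ} (hc : 0 < c) (r : ℝ) : 0 < freq c r := hc.trans_le (le_freq r)

theorem le_freq_left (c r : ℝ) : r ≤ freq c r :=
  Real.le_sqrt_of_sq_le (by nlinarith [sq_nonneg c])

theorem integrable_freq_rpow_neg {c : ℝ} (hc : 0 < c) {p : ℝ} (hp : 3 < p) :
    Integrable fun k : Momentum => freq c ‖k‖ ^ (-p) := by
  have h := (integrable_rpow_neg_one_add_norm_sq (E := Momentum) (μ := volume) (r := p)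
    (by simpa using hp)).const_mul ((min 1 (c ^ 2)) ^ (-p / 2))
  -- Comparison with the standard weight: `min 1 (c²) · (1 + ‖k‖²) ≤ ‖k‖² + c²`, raised to a
  -- negative power.
  have hmin : 0 < min 1 (c ^ 2) := lt_min one_pos (by positivity)
  refine h.mono' ?_ (Filter.Eventually.of_forall fun k => ?_)
  · exact (((continuous_freq c).comp continuous_norm).rpow_const
      fun k => Or.inl (freq_pos hc _).ne').aestronglyMeasurable
  · rw [Real.norm_of_nonneg (Real.rpow_nonneg (freq_pos hc _).le _),
      ← Real.mul_rpow hmin.le (by positivity)]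
    have : freq c ‖k‖ ^ (-p) = (‖k‖ ^ 2 + c ^ 2) ^ (-p / 2) := by
      rw [freq, Real.sqrt_eq_rpow, ← Real.rpow_mul (by positivity)]
      congr 1; ring
    rw [this]
    refine Real.rpow_le_rpow_of_nonpos (by positivity) ?_ (by linarith)
    nlinarith [min_le_left 1 (c ^ 2), min_le_right 1 (c ^ 2), sq_nonneg ‖k‖]

theorem integrable_sq_cosIntegral {g : ℝ → ℝ} (hg : Continuous g) {M : ℝ} (hM : ∀ x, |g x| ≤ M)
    {τ₀ τ : ℝ} (hτ : τ₀ ≤ τ) :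
    (Integrable fun ω => cosIntegral g τ₀ τ ω ^ 2) ∧
      ∫ ω, cosIntegral g τ₀ τ ω ^ 2 ≤ Real.pi * (M ^ 2 * (τ - τ₀)) := by
  have hle := lintegral_sq_cosIntegral_le hg hM hτ
  have hc := ((continuous_cosIntegral hg τ₀ τ).pow 2).aestronglyMeasurable (μ := volume)
  refine ⟨(lintegral_ofReal_ne_top_iff_integrable hc
    (Filter.Eventually.of_forall fun _ => sq_nonneg _)).1 (hle.trans_lt ENNReal.ofReal_lt_top).ne, ?_⟩
  rw [integral_eq_lintegral_of_nonneg_ae (Filter.Eventually.of_forall fun _ => sq_nonneg _) hc]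
  refine ENNReal.toReal_le_of_le_ofReal ?_ hle
  have := sub_nonneg.2 hτ
  have := Real.pi_pos
  positivity

/-- Polar coordinates give the factor `r²`; substituting `ω = √(r² + c²)` gives `dω = (r/ω) dr`, and
`(r/ω)² ≤ r/ω`. This transfers the one-dimensional Plancherel bound to momentum space. -/
theorem integrable_comp_freq {c : ℝ} (hc : 0 < c) {F : ℝ → ℝ} (hF : Continuous F)
    (hpos : ∀ ω, 0 ≤ F ω) (hint : Integrable F) :
    (Integrable fun k : Momentum => F (freq c ‖k‖) / freq c ‖k‖ ^ 2) ∧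
      ∫ k : Momentum, F (freq c ‖k‖) / freq c ‖k‖ ^ 2 ≤
        3 * volume.real (Metric.ball (0 : Momentum) 1) * ∫ ω, F ω := by
  have hderiv : ∀ x ∈ Set.Ioi (0 : ℝ), HasDerivWithinAt (freq c) (x / freq c x) (Set.Ioi 0) x := by
    intro x _
    have h := ((hasDerivAt_pow 2 x).add_const (c ^ 2)).sqrt (by positivity)
    refine (h.congr_deriv ?_).hasDerivWithinAt
    unfold freq
    field_simp
    norm_num
  have hinj : Set.InjOn (freq c) (Set.Ioi 0) := by
    intro x hx y hy hxy
    have : x ^ 2 = y ^ 2 := by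
      have := congrArg (· ^ 2) hxy
      simp only [sq_freq] at this
      linarith
    exact (pow_left_inj₀ (le_of_lt hx) (le_of_lt hy) two_ne_zero).1 this
  have h1 := (integrableOn_image_iff_integrableOn_abs_deriv_smul measurableSet_Ioi hderiv hinj F).1
    hint.integrableOn
  have h2 := integral_image_eq_integral_abs_deriv_smul measurableSet_Ioi hderiv hinj F
  have hbound : ∀ x ∈ Set.Ioi (0 : ℝ), x ^ 2 • (F (freq c x) / freq c x ^ 2) ≤
      |x / freq c x| • F (freq c x) := by
    intro x hx
    have hx0 : 0 < x := hx
    have hf := freq_pos hc x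
    have hle : x / freq c x ≤ 1 := (div_le_one hf).2 (le_freq_left c x)
    have h0 : 0 ≤ x / freq c x := by positivity
    rw [abs_of_nonneg h0, smul_eq_mul, smul_eq_mul]
    calc x ^ 2 * (F (freq c x) / freq c x ^ 2) = (x / freq c x) ^ 2 * F (freq c x) := by
          field_simp
      _ ≤ _ := mul_le_mul_of_nonneg_right (by nlinarith) (hpos _)
  have hcont : Continuous fun x : ℝ => x ^ 2 • (F (freq c x) / freq c x ^ 2) := by
    have := continuous_freq c
    refine (continuous_pow 2).smul ((hF.comp this).div₀ (this.pow 2) fun x => ?_)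
    exact (pow_pos (freq_pos hc x) 2).ne'
  have hint1 : IntegrableOn (fun x : ℝ => x ^ 2 • (F (freq c x) / freq c x ^ 2)) (Set.Ioi 0) := by
    refine h1.mono' hcont.aestronglyMeasurable ?_
    refine (ae_restrict_iff' measurableSet_Ioi).2 (Filter.Eventually.of_forall fun x hx => ?_)
    rw [Real.norm_of_nonneg]
    · exact hbound x hx
    · exact smul_nonneg (sq_nonneg _) (div_nonneg (hpos _) (sq_nonneg _))
  have hdim : Module.finrank ℝ Momentum = 3 := by simp
  constructor
  · refine (integrable_fun_norm_addHaar volume (E := Momentum)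
      (f := fun r => F (freq c r) / freq c r ^ 2)).2 ?_
    rw [hdim]
    exact hint1
  · rw [integral_fun_norm_addHaar volume (E := Momentum)
      (fun r => F (freq c r) / freq c r ^ 2), hdim, nsmul_eq_mul, smul_eq_mul, ← mul_assoc]
    refine mul_le_mul_of_nonneg_left ?_ (by positivity)
    calc _ ≤ ∫ x in Set.Ioi (0 : ℝ), |x / freq c x| • F (freq c x) :=
          setIntegral_mono_on hint1 h1 measurableSet_Ioi hbound
      _ = ∫ x in freq c '' Set.Ioi 0, F x := h2.symm
      _ ≤ _ := setIntegral_le_integral hint (Filter.Eventually.of_forall hpos)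

/-- Oscillation improves the borderline decay `κ⁻³` to an integrable one, with a weight to spare. -/
theorem exists_integral_cosIntegral_le {c : ℝ} (hc : 0 < c) :
    ∃ C : ℝ, 0 ≤ C ∧ ∀ (g : ℝ → ℝ) (M τ₀ τ : ℝ), Continuous g → (∀ x, |g x| ≤ M) → τ₀ ≤ τ →
      τ ≤ τ₀ + 1 →
      (Integrable fun k : Momentum =>
        freq c ‖k‖ ^ (-(11 / 4 : ℝ)) * |cosIntegral g τ₀ τ (freq c ‖k‖)|) ∧
      ∫ k : Momentum, freq c ‖k‖ ^ (-(11 / 4 : ℝ)) * |cosIntegral g τ₀ τ (freq c ‖k‖)| ≤ C * M := by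
  set A := ∫ k : Momentum, freq c ‖k‖ ^ (-(7 / 2 : ℝ)) with hA
  set B := 3 * volume.real (Metric.ball (0 : Momentum) 1) * Real.pi with hB
  have hA0 : 0 ≤ A := integral_nonneg fun k => Real.rpow_nonneg (freq_pos hc _).le _
  have hB0 : 0 ≤ B := by have := Real.pi_pos; positivity
  refine ⟨A + B, by positivity, fun g M τ₀ τ hg hM h1 h2 => ?_⟩
  have hM0 : 0 ≤ M := (abs_nonneg _).trans (hM 0)
  rcases hM0.eq_or_lt with rfl | hMpos
  · have hg0 : ∀ x, g x = 0 := fun x => abs_nonpos_iff.1 (hM x)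
    simp [cosIntegral, hg0]
  obtain ⟨i1, i2⟩ := integrable_sq_cosIntegral hg hM h1
  obtain ⟨j1, j2⟩ := integrable_comp_freq hc (F := fun ω => cosIntegral g τ₀ τ ω ^ 2)
    ((continuous_cosIntegral hg τ₀ τ).pow 2)
    (fun _ => sq_nonneg _) i1
  have hp := integrable_freq_rpow_neg hc (p := 7 / 2) (by norm_num)
  -- The weights `M` and `M⁻¹` in Young's inequality make both halves linear in `M`, since the
  -- integral of the squared term is at most a constant times `M²`. The division is why `M = 0` is
  -- treated apart.
  have hdom := (hp.const_mul M).add (j1.const_mul M⁻¹)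
  have hbound : ∀ k : Momentum,
      freq c ‖k‖ ^ (-(11 / 4 : ℝ)) * |cosIntegral g τ₀ τ (freq c ‖k‖)| ≤
        M * freq c ‖k‖ ^ (-(7 / 2 : ℝ)) +
          M⁻¹ * (cosIntegral g τ₀ τ (freq c ‖k‖) ^ 2 / freq c ‖k‖ ^ 2) := by
    intro k
    set κ := freq c ‖k‖
    set F := cosIntegral g τ₀ τ κ
    have hκ : 0 < κ := freq_pos hc _
    have e1 : κ ^ (-(11 / 4 : ℝ)) = κ ^ (-(7 / 4 : ℝ)) * κ⁻¹ := by
      rw [← Real.rpow_neg_one, ← Real.rpow_add hκ]; norm_num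
    have e2 : κ ^ (-(7 / 2 : ℝ)) = (κ ^ (-(7 / 4 : ℝ))) ^ 2 := by
      rw [← Real.rpow_natCast, ← Real.rpow_mul hκ.le]; norm_num
    rw [e1, e2]
    set p := κ ^ (-(7 / 4 : ℝ))
    have e3 : F ^ 2 / κ ^ 2 = (κ⁻¹ * |F|) ^ 2 := by rw [mul_pow, sq_abs]; field_simp
    rw [e3, mul_assoc]
    set q := κ⁻¹ * |F|
    have hp0 : 0 ≤ p := Real.rpow_nonneg hκ.le _
    have hq0 : 0 ≤ q := by positivity
    have key : M * p ^ 2 + M⁻¹ * q ^ 2 - p * q = M⁻¹ * ((M * p - q) ^ 2 + M * p * q) := by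
      field_simp; ring
    have : 0 ≤ M⁻¹ * ((M * p - q) ^ 2 + M * p * q) := by positivity
    linarith
  have hcont : Continuous fun k : Momentum =>
      freq c ‖k‖ ^ (-(11 / 4 : ℝ)) * |cosIntegral g τ₀ τ (freq c ‖k‖)| := by
    have hf : Continuous fun k : Momentum => freq c ‖k‖ := (continuous_freq c).comp continuous_norm
    exact (hf.rpow_const fun k => Or.inl (freq_pos hc _).ne').mul
      ((continuous_cosIntegral hg τ₀ τ).comp hf).abs
  have hint : Integrable fun k : Momentum =>
      freq c ‖k‖ ^ (-(11 / 4 : ℝ)) * |cosIntegral g τ₀ τ (freq c ‖k‖)| := by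
    refine hdom.mono' hcont.aestronglyMeasurable (Filter.Eventually.of_forall fun k => ?_)
    rw [Real.norm_of_nonneg (mul_nonneg (Real.rpow_nonneg (freq_pos hc _).le _) (abs_nonneg _))]
    exact hbound k
  refine ⟨hint, (integral_mono hint hdom hbound).trans ?_⟩
  simp only [Pi.add_apply]
  rw [integral_add (hp.const_mul M) (j1.const_mul M⁻¹), integral_const_mul, integral_const_mul]
  have hj : ∫ k : Momentum, cosIntegral g τ₀ τ (freq c ‖k‖) ^ 2 / freq c ‖k‖ ^ 2 ≤ B * M ^ 2 := by
    refine j2.trans ?_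
    rw [hB, mul_assoc (3 * _)]
    refine mul_le_mul_of_nonneg_left (i2.trans ?_) (by positivity)
    refine mul_le_mul_of_nonneg_left ?_ Real.pi_pos.le
    nlinarith [sq_nonneg M]
  have : M⁻¹ * ∫ k : Momentum, cosIntegral g τ₀ τ (freq c ‖k‖) ^ 2 / freq c ‖k‖ ^ 2 ≤ B * M := by
    rw [inv_mul_le_iff₀ hMpos]
    linarith
  nlinarith

/-! ### The perturbative expansion of a single mode -/

/-- The terms of the perturbation series for `χ'' + (κ² + V) χ = 0`. -/
noncomputable def pert (κ τ₀ : ℝ) (V : ℝ → ℝ) : ℕ → ℝ → ℂ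
  | 0, τ => ((1 / Real.sqrt (2 * κ) : ℝ) : ℂ) * Complex.exp (Complex.I * ((κ * τ : ℝ) : ℂ))
  | n + 1, τ => ∫ η in τ₀..τ, ((Real.sin (κ * (η - τ)) / κ * V η : ℝ) : ℂ) * pert κ τ₀ V n η

/-- The sum of the perturbation series. -/
noncomputable def pertSum (κ τ₀ : ℝ) (V : ℝ → ℝ) (τ : ℝ) : ℂ := ∑' n, pert κ τ₀ V n τ

theorem modeTerm_eq_pert (m τ₀ : ℝ) (a : ℝ → ℝ) (k : ℝ) (n : ℕ) (τ : ℝ) :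
    modeTerm m τ₀ a k n τ = pert (initialFrequency m τ₀ a k) τ₀ (potential m τ₀ a) n τ := by
  induction n generalizing τ with
  | zero => rfl
  | succ n ih => simp only [modeTerm, pert, ih]

/-- Causality of the series: it allows the potential to be replaced by one defined and regular on
the whole line. -/
theorem pert_congr {κ τ₀ τ₁ : ℝ} {V W : ℝ → ℝ} (h : ∀ η ∈ Set.Icc τ₀ τ₁, V η = W η) (n : ℕ)
    {τ : ℝ} (hτ : τ ∈ Set.Icc τ₀ τ₁) : pert κ τ₀ V n τ = pert κ τ₀ W n τ := by
  induction n generalizing τ with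
  | zero => rfl
  | succ n ih =>
    refine intervalIntegral.integral_congr fun η hη => ?_
    rw [Set.uIcc_of_le hτ.1] at hη
    have hη' : η ∈ Set.Icc τ₀ τ₁ := ⟨hη.1, hη.2.trans hτ.2⟩
    simp only [h η hη', ih hη']

theorem continuous_pert {X : Type} [TopologicalSpace X] {κ s : X → ℝ} {τ₀ : ℝ} {V : ℝ → ℝ}
    (hκ : Continuous κ) (hκ0 : ∀ x, 0 < κ x) (hs : Continuous s) (hV : Continuous V) (n : ℕ) :
    Continuous fun x => pert (κ x) τ₀ V n (s x) := by
  -- The parameter space must vary: the recursive step needs joint continuity in the parameter and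
  -- the integration variable, that is, the claim over `X × ℝ`.
  induction n generalizing X with
  | zero =>
    have : Continuous fun x => 1 / Real.sqrt (2 * κ x) :=
      continuous_const.div (by fun_prop) fun x =>
        (Real.sqrt_pos.2 (mul_pos two_pos (hκ0 x))).ne'
    simp only [pert]
    fun_prop
  | succ n ih =>
    simp only [pert]
    refine intervalIntegral.continuous_parametric_intervalIntegral_of_continuous
      (f := fun x η => ((Real.sin (κ x * (η - s x)) / κ x * V η : ℝ) : ℂ) * pert (κ x) τ₀ V n η)
      ?_ hs
    simp only [Function.uncurry_def]
    have h1 := ih (X := X × ℝ) (κ := fun p => κ p.1) (s := Prod.snd) (by fun_prop)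
      (fun p => hκ0 _) continuous_snd
    have h2 : Continuous fun p : X × ℝ => Real.sin (κ p.1 * (p.2 - s p.1)) / κ p.1 :=
      Continuous.div (by fun_prop) (by fun_prop) fun p => (hκ0 _).ne'
    fun_prop

theorem norm_pert_zero {κ : ℝ} (τ₀ : ℝ) (V : ℝ → ℝ) (τ : ℝ) :
    ‖pert κ τ₀ V 0 τ‖ = 1 / Real.sqrt (2 * κ) := by
  rw [pert, norm_mul, mul_comm Complex.I, Complex.norm_exp_ofReal_mul_I, mul_one,
    Complex.norm_real, Real.norm_of_nonneg (by positivity)]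

/-- Each iteration costs a factor `K T / κ ≤ 1/2`. A geometric bound suffices on short intervals, so
no factorials are needed. -/
theorem norm_pert_le {κ τ₀ T K : ℝ} {V : ℝ → ℝ} (hκ : 0 < κ)
    (hV : ∀ η ∈ Set.Icc τ₀ (τ₀ + T), |V η| ≤ K) (hK : 2 * (K * T) ≤ κ) (n : ℕ)
    {τ : ℝ} (hτ : τ ∈ Set.Icc τ₀ (τ₀ + T)) :
    ‖pert κ τ₀ V n τ‖ ≤ 1 / Real.sqrt (2 * κ) * (1 / 2) ^ n := by
  induction n generalizing τ with
  | zero => rw [norm_pert_zero, pow_zero, mul_one]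
  | succ n ih =>
    set b := 1 / Real.sqrt (2 * κ) * (1 / 2) ^ n with hb
    have hb0 : 0 ≤ b := by positivity
    have hK0 : 0 ≤ K := (abs_nonneg _).trans (hV τ hτ)
    have hle : ‖pert κ τ₀ V (n + 1) τ‖ ≤ (1 / κ * K * b) * |τ - τ₀| := by
      refine intervalIntegral.norm_integral_le_of_norm_le_const fun η hη => ?_
      rw [Set.uIoc_of_le hτ.1] at hη
      have hη' : η ∈ Set.Icc τ₀ (τ₀ + T) := ⟨hη.1.le, hη.2.trans hτ.2⟩
      rw [norm_mul, Complex.norm_real, norm_mul, norm_div, Real.norm_of_nonneg hκ.le]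
      gcongr
      · exact Real.abs_sin_le_one _
      · exact hV η hη'
      · exact ih hη'
    refine hle.trans ?_
    rw [abs_of_nonneg (sub_nonneg.2 hτ.1), pow_succ, ← mul_assoc (1 / Real.sqrt _), ← hb]
    have h1 : K * (τ - τ₀) ≤ K * T := mul_le_mul_of_nonneg_left (by linarith [hτ.2]) hK0
    calc 1 / κ * K * b * (τ - τ₀) = b * (K * (τ - τ₀) / κ) := by ring
      _ ≤ b * (1 / 2) := by
        refine mul_le_mul_of_nonneg_left ?_ hb0
        rw [div_le_iff₀ hκ]; linarith

theorem summable_pert {κ τ₀ T K : ℝ} {V : ℝ → ℝ} (hκ : 0 < κ)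
    (hV : ∀ η ∈ Set.Icc τ₀ (τ₀ + T), |V η| ≤ K) (hK : 2 * (K * T) ≤ κ)
    {τ : ℝ} (hτ : τ ∈ Set.Icc τ₀ (τ₀ + T)) : Summable fun n => pert κ τ₀ V n τ :=
  Summable.of_norm_bounded ((summable_geometric_two).mul_left _)
    fun n => norm_pert_le hκ hV hK n hτ

theorem continuousOn_pertSum {κ τ₀ T K : ℝ} {V : ℝ → ℝ} (hκ : 0 < κ) (hVc : Continuous V)
    (hV : ∀ η ∈ Set.Icc τ₀ (τ₀ + T), |V η| ≤ K) (hK : 2 * (K * T) ≤ κ) :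
    ContinuousOn (pertSum κ τ₀ V) (Set.Icc τ₀ (τ₀ + T)) :=
  continuousOn_tsum
    (fun n => (continuous_pert continuous_const (fun _ => hκ) continuous_id hVc n).continuousOn)
    ((summable_geometric_two).mul_left (1 / Real.sqrt (2 * κ)))
    fun n _ hτ => norm_pert_le hκ hV hK n hτ

theorem pertSum_eq {κ τ₀ T K : ℝ} {V : ℝ → ℝ} (hκ : 0 < κ) (hVc : Continuous V)
    (hV : ∀ η ∈ Set.Icc τ₀ (τ₀ + T), |V η| ≤ K) (hK : 2 * (K * T) ≤ κ)
    {τ : ℝ} (hτ : τ ∈ Set.Icc τ₀ (τ₀ + T)) :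
    pertSum κ τ₀ V τ = pert κ τ₀ V 0 τ +
      ∫ η in τ₀..τ, ((Real.sin (κ * (η - τ)) / κ * V η : ℝ) : ℂ) * pertSum κ τ₀ V η := by
  have hK0 : 0 ≤ K := (abs_nonneg _).trans (hV τ hτ)
  have hgeo : Summable fun n : ℕ => 1 / κ * K * (1 / Real.sqrt (2 * κ) * (1 / 2) ^ n) :=
    ((summable_geometric_two).mul_left _).mul_left _
  have hmem : ∀ η ∈ Set.uIoc τ₀ τ, η ∈ Set.Icc τ₀ (τ₀ + T) := fun η hη => by
    rw [Set.uIoc_of_le hτ.1] at hη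
    exact ⟨hη.1.le, hη.2.trans hτ.2⟩
  have h : HasSum (fun n => pert κ τ₀ V (n + 1) τ)
      (∫ η in τ₀..τ, ((Real.sin (κ * (η - τ)) / κ * V η : ℝ) : ℂ) * pertSum κ τ₀ V η) := by
    refine intervalIntegral.hasSum_integral_of_dominated_convergence
      (F := fun n η => ((Real.sin (κ * (η - τ)) / κ * V η : ℝ) : ℂ) * pert κ τ₀ V n η)
      (fun n _ => 1 / κ * K * (1 / Real.sqrt (2 * κ) * (1 / 2) ^ n)) (fun n => ?_) (fun n => ?_)
      (Filter.Eventually.of_forall fun _ _ => hgeo) (by simp)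
      (Filter.Eventually.of_forall fun η hη => ?_)
    · have := continuous_pert (τ₀ := τ₀) (κ := fun _ : ℝ => κ) (s := fun η : ℝ => η)
        continuous_const (fun _ => hκ) continuous_id hVc n
      exact Continuous.aestronglyMeasurable (by fun_prop)
    · refine Filter.Eventually.of_forall fun η hη => ?_
      rw [norm_mul, Complex.norm_real, norm_mul, norm_div, Real.norm_of_nonneg hκ.le]
      gcongr
      · exact Real.abs_sin_le_one _
      · exact hV η (hmem η hη)
      · exact norm_pert_le hκ hV hK n (hmem η hη)
    · exact ((summable_pert hκ hV hK (hmem η hη)).hasSum).mul_left _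
  rw [pertSum, (summable_pert hκ hV hK hτ).tsum_eq_zero_add, h.tsum_eq]

/-! ### The equation of motion -/

/-- A function that agrees with the mode on `[τ₀, τ₀ + T]` solves the mode equation there. -/
theorem exists_mode_solution {κ τ₀ T K : ℝ} {V : ℝ → ℝ} (hκ : 0 < κ) (hT : 0 ≤ T)
    (hVc : Continuous V) (hV : ∀ η ∈ Set.Icc τ₀ (τ₀ + T), |V η| ≤ K) (hK : 2 * (K * T) ≤ κ) :
    ∃ χ ψ : ℝ → ℂ, (∀ τ, HasDerivAt χ (ψ τ) τ) ∧
      (∀ τ ∈ Set.Icc τ₀ (τ₀ + T), χ τ = pertSum κ τ₀ V τ ∧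
        HasDerivAt ψ (-((κ ^ 2 + V τ : ℝ) : ℂ) * χ τ) τ) ∧
      χ τ₀ = pert κ τ₀ V 0 τ₀ ∧ ψ τ₀ = Complex.I * κ * pert κ τ₀ V 0 τ₀ := by
  have hle : τ₀ ≤ τ₀ + T := by linarith
  -- The constant extension is continuous on the line, so two-sided derivatives exist also at the
  -- endpoints of the interval.
  set X : ℝ → ℂ := Set.IccExtend hle (Set.domRestrict _ (pertSum κ τ₀ V)) with hX
  have hXc : Continuous X :=
    (continuousOn_iff_continuous_domRestrict.1 (continuousOn_pertSum hκ hVc hV hK)).Icc_extend'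
  have hXe : ∀ τ ∈ Set.Icc τ₀ (τ₀ + T), X τ = pertSum κ τ₀ V τ := fun τ hτ => by
    rw [hX, Set.IccExtend_of_mem _ _ hτ, Set.domRestrict_apply]
  -- Variation of parameters: the addition formula splits the kernel `sin(κ(η - τ))`, so that `τ`
  -- occurs only as a limit of integration and the fundamental theorem of calculus applies.
  set A : ℝ → ℂ := fun τ => ∫ η in τ₀..τ, ((Real.sin (κ * η) / κ * V η : ℝ) : ℂ) * X η with hA
  set B : ℝ → ℂ := fun τ => ∫ η in τ₀..τ, ((Real.cos (κ * η) / κ * V η : ℝ) : ℂ) * X η with hB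
  have hcA : Continuous fun η => ((Real.sin (κ * η) / κ * V η : ℝ) : ℂ) * X η := by fun_prop
  have hcB : Continuous fun η => ((Real.cos (κ * η) / κ * V η : ℝ) : ℂ) * X η := by fun_prop
  have hdA : ∀ τ, HasDerivAt A (((Real.sin (κ * τ) / κ * V τ : ℝ) : ℂ) * X τ) τ := fun τ =>
    (hcA.integral_hasStrictDerivAt τ₀ τ).hasDerivAt
  have hdB : ∀ τ, HasDerivAt B (((Real.cos (κ * τ) / κ * V τ : ℝ) : ℂ) * X τ) τ := fun τ =>
    (hcB.integral_hasStrictDerivAt τ₀ τ).hasDerivAt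
  have hlin : ∀ τ : ℝ, HasDerivAt (fun t : ℝ => κ * t) κ τ := fun τ => by
    simpa using (hasDerivAt_id τ).const_mul κ
  have hcos : ∀ τ : ℝ, HasDerivAt (fun t : ℝ => ((Real.cos (κ * t) : ℝ) : ℂ))
      ((-Real.sin (κ * τ) * κ : ℝ) : ℂ) τ := fun τ => (hlin τ).cos.ofReal_comp
  have hsin : ∀ τ : ℝ, HasDerivAt (fun t : ℝ => ((Real.sin (κ * t) : ℝ) : ℂ))
      ((Real.cos (κ * τ) * κ : ℝ) : ℂ) τ := fun τ => (hlin τ).sin.ofReal_comp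
  have h0 : ∀ τ : ℝ, HasDerivAt (pert κ τ₀ V 0) (Complex.I * κ * pert κ τ₀ V 0 τ) τ := by
    intro τ
    have h1 := (((hlin τ).ofReal_comp.const_mul Complex.I).cexp).const_mul
      ((1 / Real.sqrt (2 * κ) : ℝ) : ℂ)
    refine (h1.congr_deriv ?_)
    simp only [pert]
    ring
  have hκC : (κ : ℂ) ≠ 0 := by exact_mod_cast hκ.ne'
  have hpyth : ∀ τ : ℝ, ((Real.sin (κ * τ) : ℝ) : ℂ) ^ 2 + ((Real.cos (κ * τ) : ℝ) : ℂ) ^ 2 = 1 :=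
    fun τ => by exact_mod_cast Real.sin_sq_add_cos_sq (κ * τ)
  set χ : ℝ → ℂ := fun τ => pert κ τ₀ V 0 τ +
    (((Real.cos (κ * τ) : ℝ) : ℂ) * A τ - ((Real.sin (κ * τ) : ℝ) : ℂ) * B τ) with hχ
  set ψ : ℝ → ℂ := fun τ => Complex.I * κ * pert κ τ₀ V 0 τ -
    κ * (((Real.sin (κ * τ) : ℝ) : ℂ) * A τ + ((Real.cos (κ * τ) : ℝ) : ℂ) * B τ) with hψ
  have hA0 : A τ₀ = 0 := by simp [hA]
  have hB0 : B τ₀ = 0 := by simp [hB]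
  have hχX : ∀ τ ∈ Set.Icc τ₀ (τ₀ + T), χ τ = pertSum κ τ₀ V τ := by
    intro τ hτ
    rw [pertSum_eq hκ hVc hV hK hτ]
    simp only [hχ, hA, hB]
    rw [← intervalIntegral.integral_const_mul, ← intervalIntegral.integral_const_mul,
      ← intervalIntegral.integral_sub (Continuous.intervalIntegrable (by fun_prop) _ _)
        (Continuous.intervalIntegrable (by fun_prop) _ _)]
    congr 1
    refine intervalIntegral.integral_congr fun η hη => ?_
    rw [Set.uIcc_of_le hτ.1] at hη
    have hη' : η ∈ Set.Icc τ₀ (τ₀ + T) := ⟨hη.1, hη.2.trans hτ.2⟩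
    simp only [hXe η hη']
    rw [mul_sub, Real.sin_sub]
    push_cast
    ring
  refine ⟨χ, ψ, fun τ => ?_, fun τ hτ => ⟨hχX τ hτ, ?_⟩, by simp [hχ, hA0, hB0],
    by simp [hψ, hA0, hB0]⟩
  · refine ((h0 τ).add (((hcos τ).mul (hdA τ)).sub ((hsin τ).mul (hdB τ)))).congr_deriv ?_
    simp only [hψ]
    push_cast
    ring
  · refine (((h0 τ).const_mul (Complex.I * κ)).sub
      ((((hsin τ).mul (hdA τ)).add ((hcos τ).mul (hdB τ))).const_mul (κ : ℂ))).congr_deriv ?_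
    have hXτ : X τ = χ τ := by rw [hXe τ hτ, hχX τ hτ]
    rw [hXτ]
    have hp := hpyth τ
    have hI : Complex.I ^ 2 = -1 := Complex.I_sq
    have e : χ τ = pert κ τ₀ V 0 τ +
      (((Real.cos (κ * τ) : ℝ) : ℂ) * A τ - ((Real.sin (κ * τ) : ℝ) : ℂ) * B τ) := rfl
    set y := χ τ
    push_cast at hp e ⊢
    field_simp
    linear_combination (κ : ℂ) ^ 2 * pert κ τ₀ V 0 τ * hI - V τ * y * hp + κ ^ 2 * e

/-! ### The Volterra equation for the mode density -/

/-- The primitive of `v` vanishing at `τ₀`. -/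
noncomputable def primitive (τ₀ : ℝ) (v : ℝ → ℝ) (τ : ℝ) : ℝ := ∫ η in τ₀..τ, v η

theorem hasDerivAt_primitive {v : ℝ → ℝ} (hv : Continuous v) (τ₀ τ : ℝ) :
    HasDerivAt (primitive τ₀ v) (v τ) τ :=
  (hv.integral_hasStrictDerivAt τ₀ τ).hasDerivAt

@[fun_prop]
theorem continuous_primitive {v : ℝ → ℝ} (hv : Continuous v) (τ₀ : ℝ) :
    Continuous (primitive τ₀ v) :=
  continuous_iff_continuousAt.2 fun τ => (hasDerivAt_primitive hv τ₀ τ).continuousAt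

@[simp]
theorem primitive_self (τ₀ : ℝ) (v : ℝ → ℝ) : primitive τ₀ v τ₀ = 0 := by simp [primitive]

/-- The memory term of the Volterra equation for `u = |χ|² - 1/(2κ)`. -/
noncomputable def memory (τ₀ : ℝ) (v u : ℝ → ℝ) (η : ℝ) : ℝ :=
  -4 * primitive τ₀ v η * u η + 2 * primitive τ₀ (fun s => v s * u s) η

@[fun_prop]
theorem continuous_memory {v u : ℝ → ℝ} (hv : Continuous v) (hu : Continuous u) (τ₀ : ℝ) :
    Continuous (memory τ₀ v u) := by
  unfold memory
  fun_prop

/-- With `χ = x + i y`, eliminating `|χ'|²` by the energy balance yields `u'' + 4κ² u = -V/κ +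
memory`. Duhamel's formula, with one integration by parts on the `V` term, produces both `V/(4κ³)`
and the cosine integral of `v = V'`. -/
theorem volterra_of_oscillator {κ τ₀ τ : ℝ} (hκ : 0 < κ) {v x y x₁ y₁ : ℝ → ℝ}
    (hv : Continuous v) (hx : ∀ t, HasDerivAt x (x₁ t) t) (hy : ∀ t, HasDerivAt y (y₁ t) t)
    (hx₁ : ∀ t ∈ Set.uIcc τ₀ τ, HasDerivAt x₁ (-(κ ^ 2 + primitive τ₀ v t) * x t) t)
    (hy₁ : ∀ t ∈ Set.uIcc τ₀ τ, HasDerivAt y₁ (-(κ ^ 2 + primitive τ₀ v t) * y t) t)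
    (h0 : x τ₀ ^ 2 + y τ₀ ^ 2 = 1 / (2 * κ)) (h1 : x τ₀ * x₁ τ₀ + y τ₀ * y₁ τ₀ = 0)
    (h2 : x₁ τ₀ ^ 2 + y₁ τ₀ ^ 2 = κ / 2) {u : ℝ → ℝ}
    (hu : ∀ t, u t = x t ^ 2 + y t ^ 2 - 1 / (2 * κ)) :
    u τ + primitive τ₀ v τ / (4 * κ ^ 3) = 1 / (4 * κ ^ 3) * cosIntegral v τ₀ τ κ +
      ∫ η in τ₀..τ, Real.sin (2 * κ * (τ - η)) / (2 * κ) * memory τ₀ v u η := by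
  have hdu : ∀ t, HasDerivAt u (2 * (x t * x₁ t + y t * y₁ t)) t := by
    intro t
    have h := ((((hx t).pow 2).add ((hy t).pow 2)).sub_const (1 / (2 * κ)))
    rw [show u = fun t => x t ^ 2 + y t ^ 2 - 1 / (2 * κ) from funext hu]
    refine h.congr_deriv ?_
    simp only [Nat.cast_ofNat, Nat.add_one_sub_one, pow_one]
    ring
  have huc : Continuous u := continuous_iff_continuousAt.2 fun t => (hdu t).continuousAt
  have hV := hasDerivAt_primitive hv τ₀
  have hJ : ∀ t, HasDerivAt (primitive τ₀ fun s => v s * u s) (v t * u t) t :=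
    hasDerivAt_primitive (hv.mul huc) τ₀
  -- The energy `|χ'|² + (κ² + V)|χ|²` has derivative `v |χ|²`; rewritten in terms of `u`, the
  -- constants `1/(2κ)` cancel.
  have energy : ∀ t ∈ Set.uIcc τ₀ τ, x₁ t ^ 2 + y₁ t ^ 2 =
      κ / 2 - κ ^ 2 * u t - primitive τ₀ v t * u t + primitive τ₀ (fun s => v s * u s) t := by
    intro t ht
    have hsub : Set.uIcc τ₀ t ⊆ Set.uIcc τ₀ τ := Set.uIcc_subset_uIcc Set.left_mem_uIcc ht
    have hd : ∀ s ∈ Set.uIcc τ₀ t, HasDerivAt (fun s => x₁ s ^ 2 + y₁ s ^ 2 + κ ^ 2 * u s +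
        primitive τ₀ v s * u s - primitive τ₀ (fun s => v s * u s) s) 0 s := by
      intro s hs
      refine ((((((hx₁ s (hsub hs)).pow 2).add ((hy₁ s (hsub hs)).pow 2)).add
        ((hdu s).const_mul (κ ^ 2))).add ((hV s).mul (hdu s))).sub (hJ s)).congr_deriv ?_
      simp only [Nat.cast_ofNat, Nat.add_one_sub_one, pow_one]
      ring
    have h := intervalIntegral.integral_eq_sub_of_hasDerivAt hd (by simp)
    have hu0 : u τ₀ = 0 := by rw [hu, h0, sub_self]
    simp only [intervalIntegral.integral_zero, primitive_self, hu0, h2] at h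
    linarith
  have hlin : ∀ s : ℝ, HasDerivAt (fun s : ℝ => 2 * κ * (τ - s)) (-(2 * κ)) s := fun s => by
    simpa using ((hasDerivAt_id s).const_sub τ).const_mul (2 * κ)
  have hu0 : u τ₀ = 0 := by rw [hu, h0, sub_self]
  -- An explicit antiderivative of the Volterra integrand: it equals the left-hand side at `s = τ`
  -- and vanishes at `s = τ₀`.
  have hd : ∀ s ∈ Set.uIcc τ₀ τ, HasDerivAt (fun s => Real.sin (2 * κ * (τ - s)) / (2 * κ) *
      (2 * (x s * x₁ s + y s * y₁ s)) +
      Real.cos (2 * κ * (τ - s)) * (u s + primitive τ₀ v s / (4 * κ ^ 3)))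
      (1 / (4 * κ ^ 3) * (Real.cos (2 * κ * (τ - s)) * v s) +
        Real.sin (2 * κ * (τ - s)) / (2 * κ) * memory τ₀ v u s) s := by
    intro s hs
    refine ((((hlin s).sin.div_const (2 * κ)).mul (((((hx s).mul (hx₁ s hs)).add
      ((hy s).mul (hy₁ s hs)))).const_mul 2)).add ((hlin s).cos.mul
        ((hdu s).add ((hV s).div_const (4 * κ ^ 3))))).congr_deriv ?_
    have e := energy s hs
    have e' : x s ^ 2 + y s ^ 2 = u s + 1 / (2 * κ) := by rw [hu]; ring
    have e2 : x₁ s * x₁ s + x s * (-(κ ^ 2 + primitive τ₀ v s) * x s) +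
        (y₁ s * y₁ s + y s * (-(κ ^ 2 + primitive τ₀ v s) * y s)) =
        (κ / 2 - κ ^ 2 * u s - primitive τ₀ v s * u s + primitive τ₀ (fun s => v s * u s) s) -
        (κ ^ 2 + primitive τ₀ v s) * (u s + 1 / (2 * κ)) := by
      rw [← e, ← e']; ring
    rw [e2]
    simp only [memory, Pi.add_apply, Pi.mul_apply]
    field_simp
    ring
  have h := intervalIntegral.integral_eq_sub_of_hasDerivAt hd
    (Continuous.intervalIntegrable (by fun_prop) _ _)
  rw [intervalIntegral.integral_add (Continuous.intervalIntegrable (by fun_prop) _ _)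
    (Continuous.intervalIntegrable (by fun_prop) _ _), intervalIntegral.integral_const_mul] at h
  simp only [sub_self, mul_zero, Real.sin_zero, zero_div, zero_mul, Real.cos_zero, one_mul,
    zero_add, h1, hu0, primitive_self, add_zero, sub_zero] at h
  rw [← h, cosIntegral]

theorem abs_primitive_le {v : ℝ → ℝ} {M τ₀ T τ : ℝ} (hM : ∀ η ∈ Set.Icc τ₀ (τ₀ + T), |v η| ≤ M)
    (hτ : τ ∈ Set.Icc τ₀ (τ₀ + T)) : |primitive τ₀ v τ| ≤ M * T := by
  have hM0 : 0 ≤ M := (abs_nonneg _).trans (hM τ hτ)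
  have h : ‖primitive τ₀ v τ‖ ≤ M * |τ - τ₀| := by
    refine intervalIntegral.norm_integral_le_of_norm_le_const fun η hη => ?_
    rw [Set.uIoc_of_le hτ.1] at hη
    exact hM η ⟨hη.1.le, hη.2.trans hτ.2⟩
  refine h.trans (mul_le_mul_of_nonneg_left ?_ hM0)
  rw [abs_of_nonneg (sub_nonneg.2 hτ.1)]
  linarith [hτ.2]

theorem exists_volterra {κ τ₀ T M : ℝ} {v : ℝ → ℝ} (hκ : 0 < κ) (hT : 0 ≤ T) (hv : Continuous v)
    (hM : ∀ τ, |v τ| ≤ M) (hsmall : 6 * M * T ^ 2 ≤ κ) :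
    ∃ u : ℝ → ℝ, Continuous u ∧ ∀ τ ∈ Set.Icc τ₀ (τ₀ + T),
      u τ = ‖pertSum κ τ₀ (primitive τ₀ v) τ‖ ^ 2 - 1 / (2 * κ) ∧
      u τ + primitive τ₀ v τ / (4 * κ ^ 3) = 1 / (4 * κ ^ 3) * cosIntegral v τ₀ τ κ +
        ∫ η in τ₀..τ, Real.sin (2 * κ * (τ - η)) / (2 * κ) * memory τ₀ v u η := by
  have hM0 : 0 ≤ M := (abs_nonneg _).trans (hM τ₀)
  obtain ⟨χ, ψ, hχ, hsol, hi0, hi1⟩ := exists_mode_solution (κ := κ) (τ₀ := τ₀) (T := T)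
    (K := M * T) (V := primitive τ₀ v) hκ hT (continuous_primitive hv τ₀)
    (fun η hη => abs_primitive_le (fun s _ => hM s) hη)
    (by nlinarith [mul_nonneg hM0 (sq_nonneg T)])
  have hχc : Continuous χ := continuous_iff_continuousAt.2 fun t => (hχ t).continuousAt
  refine ⟨fun t => (χ t).re ^ 2 + (χ t).im ^ 2 - 1 / (2 * κ), by fun_prop, fun τ hτ => ⟨?_, ?_⟩⟩
  · rw [← (hsol τ hτ).1, ← Complex.normSq_eq_norm_sq, Complex.normSq_apply]
    ring
  · have hsub : Set.uIcc τ₀ τ ⊆ Set.Icc τ₀ (τ₀ + T) := by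
      rw [Set.uIcc_of_le hτ.1]
      exact Set.Icc_subset_Icc_right hτ.2
    have hz : (pert κ τ₀ (primitive τ₀ v) 0 τ₀).re ^ 2 +
        (pert κ τ₀ (primitive τ₀ v) 0 τ₀).im ^ 2 = 1 / (2 * κ) := by
      have : ‖pert κ τ₀ (primitive τ₀ v) 0 τ₀‖ ^ 2 = 1 / (2 * κ) := by
        rw [norm_pert_zero, div_pow, Real.sq_sqrt (by positivity), one_pow]
      rw [← this, ← Complex.normSq_eq_norm_sq, Complex.normSq_apply]
      ring
    set z := pert κ τ₀ (primitive τ₀ v) 0 τ₀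
    refine volterra_of_oscillator (x := fun t => (χ t).re) (y := fun t => (χ t).im)
      (x₁ := fun t => (ψ t).re) (y₁ := fun t => (ψ t).im) hκ hv
      (fun t => Complex.reCLM.hasFDerivAt.comp_hasDerivAt t (hχ t))
      (fun t => Complex.imCLM.hasFDerivAt.comp_hasDerivAt t (hχ t))
      (fun t ht => ?_) (fun t ht => ?_) ?_ ?_ ?_ (fun t => rfl)
    · refine (Complex.reCLM.hasFDerivAt.comp_hasDerivAt t (hsol t (hsub ht)).2).congr_deriv ?_
      rw [Complex.reCLM_apply, ← Complex.ofReal_neg, Complex.re_ofReal_mul]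
    · refine (Complex.imCLM.hasFDerivAt.comp_hasDerivAt t (hsol t (hsub ht)).2).congr_deriv ?_
      rw [Complex.imCLM_apply, ← Complex.ofReal_neg, Complex.im_ofReal_mul]
    · simp only [hi0]; exact hz
    · simp only [hi0, hi1]
      simp
      ring
    · simp only [hi1]
      have : (z.re ^ 2 + z.im ^ 2) * κ ^ 2 = κ / 2 := by rw [hz]; field_simp
      rw [← this]
      simp
      ring

/-! ### Bounds on the mode density -/

/-- Absorption: by compactness the supremum `B` of `|u|` is attained, so `B ≤ A + B/2`. -/
theorem abs_le_of_abs_le_add_half {a b A : ℝ} (hab : a ≤ b) {u : ℝ → ℝ} (hu : Continuous u)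
    (h : ∀ B, (∀ s ∈ Set.Icc a b, |u s| ≤ B) → ∀ s ∈ Set.Icc a b, |u s| ≤ A + B / 2) :
    ∀ s ∈ Set.Icc a b, |u s| ≤ 2 * A := by
  obtain ⟨x, hx, hmax⟩ := isCompact_Icc.exists_isMaxOn (Set.nonempty_Icc.2 hab)
    hu.abs.continuousOn
  have hB : ∀ s ∈ Set.Icc a b, |u s| ≤ |u x| := fun s hs => hmax hs
  intro s hs
  have h1 := h _ hB x hx
  have h2 := hB s hs
  linarith

theorem abs_memory_le {v u : ℝ → ℝ} {M B τ₀ T η : ℝ} (hM : ∀ s ∈ Set.Icc τ₀ (τ₀ + T), |v s| ≤ M)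
    (hB : ∀ s ∈ Set.Icc τ₀ (τ₀ + T), |u s| ≤ B) (hη : η ∈ Set.Icc τ₀ (τ₀ + T)) :
    |memory τ₀ v u η| ≤ 6 * (M * T * B) := by
  have hM0 : 0 ≤ M := (abs_nonneg _).trans (hM η hη)
  have hT : 0 ≤ T := by linarith [hη.1, hη.2]
  have h1 : |primitive τ₀ v η * u η| ≤ M * T * B := by
    rw [abs_mul]
    exact mul_le_mul (abs_primitive_le hM hη) (hB η hη) (abs_nonneg _) (by positivity)
  have h2 : |primitive τ₀ (fun s => v s * u s) η| ≤ M * B * T :=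
    abs_primitive_le (fun s hs => by
      rw [abs_mul]
      exact mul_le_mul (hM s hs) (hB s hs) (abs_nonneg _) hM0) hη
  rw [memory, mul_assoc]
  rw [abs_le] at h1 h2 ⊢
  constructor <;> nlinarith [h1.1, h1.2, h2.1, h2.2]

/-- `memory` is bilinear in `(v, u)`. -/
theorem memory_sub {v₁ v₂ u₁ u₂ : ℝ → ℝ} (hv₁ : Continuous v₁) (hv₂ : Continuous v₂)
    (hu₁ : Continuous u₁) (hu₂ : Continuous u₂) (τ₀ η : ℝ) :
    memory τ₀ v₁ u₁ η - memory τ₀ v₂ u₂ η =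
      memory τ₀ (fun s => v₁ s - v₂ s) u₁ η + memory τ₀ v₂ (fun s => u₁ s - u₂ s) η := by
  have e1 : primitive τ₀ (fun s => v₁ s - v₂ s) η = primitive τ₀ v₁ η - primitive τ₀ v₂ η :=
    intervalIntegral.integral_sub (hv₁.intervalIntegrable _ _) (hv₂.intervalIntegrable _ _)
  have e2 : primitive τ₀ (fun s => (v₁ s - v₂ s) * u₁ s) η +
      primitive τ₀ (fun s => v₂ s * (u₁ s - u₂ s)) η =
      primitive τ₀ (fun s => v₁ s * u₁ s) η - primitive τ₀ (fun s => v₂ s * u₂ s) η := by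
    unfold primitive
    rw [← intervalIntegral.integral_add (Continuous.intervalIntegrable (by fun_prop) _ _)
      (Continuous.intervalIntegrable (by fun_prop) _ _), ← intervalIntegral.integral_sub
      (Continuous.intervalIntegrable (by fun_prop) _ _)
      (Continuous.intervalIntegrable (by fun_prop) _ _)]
    congr 1
    ext s
    ring
  simp only [memory, e1]
  linear_combination (-2) * e2

theorem abs_integral_sin_mul_le {κ τ₀ T τ Q : ℝ} {q : ℝ → ℝ} (hκ : 0 < κ)
    (hQ : ∀ s ∈ Set.Icc τ₀ (τ₀ + T), |q s| ≤ Q) (hτ : τ ∈ Set.Icc τ₀ (τ₀ + T)) :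
    |∫ η in τ₀..τ, Real.sin (2 * κ * (τ - η)) / (2 * κ) * q η| ≤ T / (2 * κ) * Q := by
  have h : |∫ η in τ₀..τ, Real.sin (2 * κ * (τ - η)) / (2 * κ) * q η| ≤ 1 / (2 * κ) * Q * T :=
    abs_primitive_le (v := fun η => Real.sin (2 * κ * (τ - η)) / (2 * κ) * q η) (fun s hs => by
      rw [abs_mul, abs_div, abs_of_pos (mul_pos two_pos hκ)]
      gcongr
      · exact Real.abs_sin_le_one _
      · exact hQ s hs) hτ
  refine h.trans (le_of_eq ?_)
  ring

theorem abs_cosIntegral_le {g : ℝ → ℝ} {M τ₀ T τ : ℝ} (κ : ℝ)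
    (hM : ∀ s ∈ Set.Icc τ₀ (τ₀ + T), |g s| ≤ M) (hτ : τ ∈ Set.Icc τ₀ (τ₀ + T)) :
    |cosIntegral g τ₀ τ κ| ≤ M * T :=
  abs_primitive_le (v := fun η => Real.cos (2 * κ * (τ - η)) * g η) (fun s hs => by
    rw [abs_mul]
    calc _ ≤ 1 * |g s| := mul_le_mul_of_nonneg_right (Real.abs_cos_le_one _) (abs_nonneg _)
      _ ≤ M := by rw [one_mul]; exact hM s hs) hτ

/-- The mode density as a function of the derivative `v` of the potential. -/
noncomputable def pertDensity (κ τ₀ : ℝ) (v : ℝ → ℝ) (τ : ℝ) : ℝ :=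
  ‖pertSum κ τ₀ (primitive τ₀ v) τ‖ ^ 2 - 1 / (2 * κ) + primitive τ₀ v τ / (4 * κ ^ 3)

theorem abs_volterra_le {κ τ₀ T M : ℝ} {v u : ℝ → ℝ} (hκ : 0 < κ) (hT : 0 ≤ T)
    (hM : ∀ τ, |v τ| ≤ M) (hsmall : 6 * M * T ^ 2 ≤ κ) (hu : Continuous u)
    (h : ∀ τ ∈ Set.Icc τ₀ (τ₀ + T),
      u τ + primitive τ₀ v τ / (4 * κ ^ 3) = 1 / (4 * κ ^ 3) * cosIntegral v τ₀ τ κ +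
        ∫ η in τ₀..τ, Real.sin (2 * κ * (τ - η)) / (2 * κ) * memory τ₀ v u η) :
    ∀ τ ∈ Set.Icc τ₀ (τ₀ + T), |u τ| ≤ M * T / κ ^ 3 := by
  have key := abs_le_of_abs_le_add_half (a := τ₀) (b := τ₀ + T) (A := M * T / (2 * κ ^ 3))
    (by linarith) hu fun B hB τ hτ => ?_
  · intro τ hτ
    refine (key τ hτ).trans (le_of_eq ?_)
    field_simp
  · have h1 := abs_primitive_le (fun s _ => hM s) hτ
    have h2 := abs_cosIntegral_le κ (fun s _ => hM s) hτ
    have h3 := abs_integral_sin_mul_le hκ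
      (fun s hs => abs_memory_le (fun s _ => hM s) hB hs) hτ
    have hB0 : 0 ≤ B := (abs_nonneg _).trans (hB τ hτ)
    -- This is where the smallness condition `6 M T² ≤ κ` comes from: the memory contributes at most
    -- `B/2`, ready for absorption.
    have h4 : T / (2 * κ) * (6 * (M * T * B)) ≤ B / 2 := by
      rw [show T / (2 * κ) * (6 * (M * T * B)) = (6 * M * T ^ 2) * B / (2 * κ) by ring,
        div_le_iff₀ (by positivity)]
      nlinarith
    have h5 : |primitive τ₀ v τ / (4 * κ ^ 3)| ≤ M * T / (4 * κ ^ 3) := by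
      rw [abs_div, abs_of_pos (show 0 < 4 * κ ^ 3 by positivity)]
      gcongr
    have h6 : |1 / (4 * κ ^ 3) * cosIntegral v τ₀ τ κ| ≤ M * T / (4 * κ ^ 3) := by
      rw [one_div_mul_eq_div, abs_div, abs_of_pos (show 0 < 4 * κ ^ 3 by positivity)]
      gcongr
    have h7 : M * T / (2 * κ ^ 3) = M * T / (4 * κ ^ 3) + M * T / (4 * κ ^ 3) := by
      field_simp; ring
    have e := h τ hτ
    rw [h7]
    rw [abs_le] at h3 h5 h6 ⊢
    constructor <;> linarith [h3.1, h3.2, h5.1, h5.2, h6.1, h6.2]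

/-- Crude bounds first give `|u₁ - u₂| ≤ 2δT/κ³` by absorption. Fed back into the memory integral,
whose kernel gains one more `κ⁻¹`, they leave a remainder of order `κ⁻⁴`; the cosine term is kept
exact for Plancherel. -/
theorem abs_pertDensity_sub_le {κ τ₀ T M δ : ℝ} {v₁ v₂ : ℝ → ℝ} (hκ : 0 < κ) (hT : 0 ≤ T)
    (hv₁ : Continuous v₁) (hv₂ : Continuous v₂) (hM₁ : ∀ τ, |v₁ τ| ≤ M) (hM₂ : ∀ τ, |v₂ τ| ≤ M)
    (hδ : ∀ τ, |v₁ τ - v₂ τ| ≤ δ) (hsmall : 6 * M * T ^ 2 ≤ κ) :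
    ∀ τ ∈ Set.Icc τ₀ (τ₀ + T), |pertDensity κ τ₀ v₁ τ - pertDensity κ τ₀ v₂ τ| ≤
      1 / (4 * κ ^ 3) * |cosIntegral (fun s => v₁ s - v₂ s) τ₀ τ κ| +
        9 * δ * M * T ^ 3 / κ ^ 4 := by
  obtain ⟨u₁, hu₁, h₁⟩ := exists_volterra (τ₀ := τ₀) hκ hT hv₁ hM₁ hsmall
  obtain ⟨u₂, hu₂, h₂⟩ := exists_volterra (τ₀ := τ₀) hκ hT hv₂ hM₂ hsmall
  have hM0 : 0 ≤ M := (abs_nonneg _).trans (hM₁ τ₀)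
  have hδ0 : 0 ≤ δ := (abs_nonneg _).trans (hδ τ₀)
  have b₁ := abs_volterra_le hκ hT hM₁ hsmall hu₁ fun τ hτ => (h₁ τ hτ).2
  have hvc : Continuous fun s => v₁ s - v₂ s := hv₁.sub hv₂
  have huc : Continuous fun s => u₁ s - u₂ s := hu₁.sub hu₂
  set R : ℝ → ℝ := fun τ => ∫ η in τ₀..τ, Real.sin (2 * κ * (τ - η)) / (2 * κ) *
    (memory τ₀ (fun s => v₁ s - v₂ s) u₁ η + memory τ₀ v₂ (fun s => u₁ s - u₂ s) η) with hR
  have hdiff : ∀ τ ∈ Set.Icc τ₀ (τ₀ + T),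
      (u₁ τ + primitive τ₀ v₁ τ / (4 * κ ^ 3)) - (u₂ τ + primitive τ₀ v₂ τ / (4 * κ ^ 3)) =
        1 / (4 * κ ^ 3) * cosIntegral (fun s => v₁ s - v₂ s) τ₀ τ κ + R τ := by
    intro τ hτ
    rw [(h₁ τ hτ).2, (h₂ τ hτ).2]
    have e1 : cosIntegral (fun s => v₁ s - v₂ s) τ₀ τ κ =
        cosIntegral v₁ τ₀ τ κ - cosIntegral v₂ τ₀ τ κ := by
      unfold cosIntegral
      rw [← intervalIntegral.integral_sub (Continuous.intervalIntegrable (by fun_prop) _ _)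
        (Continuous.intervalIntegrable (by fun_prop) _ _)]
      simp only [mul_sub]
    have e2 : R τ = (∫ η in τ₀..τ, Real.sin (2 * κ * (τ - η)) / (2 * κ) * memory τ₀ v₁ u₁ η) -
        ∫ η in τ₀..τ, Real.sin (2 * κ * (τ - η)) / (2 * κ) * memory τ₀ v₂ u₂ η := by
      rw [← intervalIntegral.integral_sub (Continuous.intervalIntegrable (by fun_prop) _ _)
        (Continuous.intervalIntegrable (by fun_prop) _ _), hR]
      simp only [← memory_sub hv₁ hv₂ hu₁ hu₂, mul_sub]
    rw [e1, e2]
    ring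
  have hRle : ∀ E, (∀ s ∈ Set.Icc τ₀ (τ₀ + T), |u₁ s - u₂ s| ≤ E) →
      ∀ τ ∈ Set.Icc τ₀ (τ₀ + T), |R τ| ≤
        T / (2 * κ) * (6 * (δ * T * (M * T / κ ^ 3)) + 6 * (M * T * E)) := by
    intro E hE τ hτ
    refine abs_integral_sin_mul_le hκ (fun s hs => (abs_add_le _ _).trans (add_le_add ?_ ?_)) hτ
    · exact abs_memory_le (fun s _ => hδ s) b₁ hs
    · exact abs_memory_le (fun s _ => hM₂ s) hE hs
  have hhalf : ∀ E, 0 ≤ E → T / (2 * κ) * (6 * (M * T * E)) ≤ E / 2 := by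
    intro E hE
    rw [show T / (2 * κ) * (6 * (M * T * E)) = (6 * M * T ^ 2) * E / (2 * κ) by ring,
      div_le_iff₀ (by positivity)]
    nlinarith
  -- `A` collects `δT/(4κ³)` from the potential, the same from the cosine integral, and `δT/(2κ³)`
  -- from the memory of `v₁ - v₂`.
  have bd := abs_le_of_abs_le_add_half (a := τ₀) (b := τ₀ + T) (A := δ * T / κ ^ 3)
    (by linarith) huc fun E hE τ hτ => ?_
  · intro τ hτ
    have h3 := hRle _ bd τ hτ
    have h4 : T / (2 * κ) * (6 * (δ * T * (M * T / κ ^ 3)) + 6 * (M * T * (2 * (δ * T / κ ^ 3)))) =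
        9 * δ * M * T ^ 3 / κ ^ 4 := by
      field_simp; ring
    have e : pertDensity κ τ₀ v₁ τ - pertDensity κ τ₀ v₂ τ =
        1 / (4 * κ ^ 3) * cosIntegral (fun s => v₁ s - v₂ s) τ₀ τ κ + R τ := by
      rw [← hdiff τ hτ, (h₁ τ hτ).1, (h₂ τ hτ).1]
      rfl
    rw [e]
    refine (abs_add_le _ _).trans (add_le_add (le_of_eq ?_) (h4 ▸ h3))
    rw [abs_mul, abs_of_pos (show 0 < 1 / (4 * κ ^ 3) by positivity)]
  · have hE0 : 0 ≤ E := (abs_nonneg _).trans (hE τ hτ)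
    have h3 := hRle E hE τ hτ
    have h4 := hhalf E hE0
    have h5 := hhalf (δ * T / κ ^ 3) (by positivity)
    have e := hdiff τ hτ
    have h6 : |(primitive τ₀ v₁ τ - primitive τ₀ v₂ τ) / (4 * κ ^ 3)| ≤ δ * T / (4 * κ ^ 3) := by
      rw [abs_div, abs_of_pos (show 0 < 4 * κ ^ 3 by positivity)]
      gcongr
      have := abs_primitive_le (v := fun s => v₁ s - v₂ s) (fun s _ => hδ s) hτ
      rwa [show primitive τ₀ (fun s => v₁ s - v₂ s) τ = primitive τ₀ v₁ τ - primitive τ₀ v₂ τ from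
        intervalIntegral.integral_sub (hv₁.intervalIntegrable _ _)
          (hv₂.intervalIntegrable _ _)] at this
    have h7 : |1 / (4 * κ ^ 3) * cosIntegral (fun s => v₁ s - v₂ s) τ₀ τ κ| ≤
        δ * T / (4 * κ ^ 3) := by
      rw [one_div_mul_eq_div, abs_div, abs_of_pos (show 0 < 4 * κ ^ 3 by positivity)]
      gcongr
      exact abs_cosIntegral_le κ (fun s _ => hδ s) hτ
    have h8 : δ * T / κ ^ 3 = δ * T / (4 * κ ^ 3) + δ * T / (4 * κ ^ 3) + δ * T / κ ^ 3 / 2 := by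
      field_simp; ring
    have h9 : T / (2 * κ) * (6 * (M * T * (δ * T / κ ^ 3))) =
        T / (2 * κ) * (6 * (δ * T * (M * T / κ ^ 3))) := by ring
    rw [mul_add] at h3
    rw [sub_div] at h6
    rw [abs_le] at h3 h6 h7 ⊢
    constructor <;> linarith [h3.1, h3.2, h6.1, h6.2, h7.1, h7.2]

/-- The base point that turns difference estimates into bounds on a single density. -/
theorem pertDensity_zero {κ τ₀ τ : ℝ} (hκ : 0 < κ) (hτ : τ₀ ≤ τ) :
    pertDensity κ τ₀ (fun _ => 0) τ = 0 := by
  have hp : ∀ t, primitive τ₀ (fun _ => 0) t = 0 := fun t => by simp [primitive]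
  obtain ⟨u, -, h⟩ := exists_volterra (κ := κ) (τ₀ := τ₀) (T := τ - τ₀) (M := 0)
    (v := fun _ => 0) hκ (by linarith) continuous_const (by simp) (by simpa using hκ.le)
  obtain ⟨h1, h2⟩ := h τ ⟨hτ, by linarith⟩
  have h3 : ∀ η, memory τ₀ (fun _ => 0) u η = 0 := fun η => by simp [memory, primitive]
  simp only [h3, hp, cosIntegral, mul_zero, intervalIntegral.integral_zero, add_zero,
    zero_div] at h2
  rw [pertDensity, ← h1, h2, hp, zero_div, add_zero]

theorem abs_pertDensity_le {κ τ₀ T M : ℝ} {v : ℝ → ℝ} (hκ : 0 < κ) (hT : 0 ≤ T)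
    (hv : Continuous v) (hM : ∀ τ, |v τ| ≤ M) (hsmall : 6 * M * T ^ 2 ≤ κ) :
    ∀ τ ∈ Set.Icc τ₀ (τ₀ + T), |pertDensity κ τ₀ v τ| ≤
      1 / (4 * κ ^ 3) * (M * T) + 9 * M * M * T ^ 3 / κ ^ 4 := by
  intro τ hτ
  have hM0 : 0 ≤ M := (abs_nonneg _).trans (hM τ₀)
  have h := abs_pertDensity_sub_le (v₂ := fun _ => 0) (δ := M) hκ hT hv continuous_const hM
    (by simpa using hM0) (by simpa using hM) hsmall τ hτ
  simp only [pertDensity_zero hκ hτ.1, sub_zero] at h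
  refine h.trans ?_
  gcongr
  exact abs_cosIntegral_le κ (fun s _ => hM s) hτ

/-! ### The momentum integral of the mode density -/

theorem continuous_pertSum_freq {c τ₀ T M τ : ℝ} {v : ℝ → ℝ} (hc : 0 < c) (hv : Continuous v)
    (hM : ∀ τ, |v τ| ≤ M) (hsmall : 6 * M * T ^ 2 ≤ c) (hτ : τ ∈ Set.Icc τ₀ (τ₀ + T)) :
    Continuous fun k : Momentum => pertSum (freq c ‖k‖) τ₀ (primitive τ₀ v) τ := by
  have hM0 : 0 ≤ M := (abs_nonneg _).trans (hM τ₀)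
  have hf : Continuous fun k : Momentum => freq c ‖k‖ := (continuous_freq c).comp continuous_norm
  refine continuous_tsum (u := fun n => 1 / Real.sqrt (2 * c) * (1 / 2) ^ n)
    (fun n => continuous_pert hf (fun k => freq_pos hc _) continuous_const
      (continuous_primitive hv τ₀) n) ((summable_geometric_two).mul_left _) fun n k => ?_
  refine (norm_pert_le (freq_pos hc _) (fun η hη => abs_primitive_le (fun s _ => hM s) hη)
    ?_ n hτ).trans ?_
  · nlinarith [le_freq (c := c) ‖k‖, mul_nonneg hM0 (sq_nonneg T)]
  · have := le_freq (c := c) ‖k‖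
    gcongr

theorem continuous_pertDensity_freq {c τ₀ T M τ : ℝ} {v : ℝ → ℝ} (hc : 0 < c) (hv : Continuous v)
    (hM : ∀ τ, |v τ| ≤ M) (hsmall : 6 * M * T ^ 2 ≤ c) (hτ : τ ∈ Set.Icc τ₀ (τ₀ + T)) :
    Continuous fun k : Momentum => pertDensity (freq c ‖k‖) τ₀ v τ := by
  have hf : Continuous fun k : Momentum => freq c ‖k‖ := (continuous_freq c).comp continuous_norm
  have h1 : ∀ k : Momentum, 2 * freq c ‖k‖ ≠ 0 := fun k => (mul_pos two_pos (freq_pos hc _)).ne'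
  have h2 : ∀ k : Momentum, 4 * freq c ‖k‖ ^ 3 ≠ 0 := fun k =>
    (mul_pos four_pos (pow_pos (freq_pos hc _) 3)).ne'
  exact (((continuous_pertSum_freq hc hv hM hsmall hτ).norm.pow 2).sub
    (continuous_const.div (by fun_prop) h1)).add (continuous_const.div (by fun_prop) h2)

theorem continuousOn_pertDensity {κ τ₀ T M : ℝ} {v : ℝ → ℝ} (hκ : 0 < κ) (hv : Continuous v)
    (hM : ∀ τ, |v τ| ≤ M) (hsmall : 6 * M * T ^ 2 ≤ κ) :
    ContinuousOn (pertDensity κ τ₀ v) (Set.Icc τ₀ (τ₀ + T)) := by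
  have hM0 : 0 ≤ M := (abs_nonneg _).trans (hM τ₀)
  have h := continuousOn_pertSum (T := T) (K := M * T) hκ (continuous_primitive hv τ₀)
    (fun η hη => abs_primitive_le (fun s _ => hM s) hη)
    (by nlinarith [mul_nonneg hM0 (sq_nonneg T)])
  exact (((h.norm).pow 2).sub continuousOn_const).add
    ((continuous_primitive hv τ₀).continuousOn.div_const _)

theorem exists_integral_pertDensity_sub_le {c M : ℝ} (hc : 0 < c) (hM : 0 ≤ M) :
    ∃ C : ℝ, 0 ≤ C ∧ ∀ (τ₀ T δ : ℝ) (v₁ v₂ : ℝ → ℝ), 0 ≤ T → T ≤ 1 → 6 * M * T ^ 2 ≤ c →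
      Continuous v₁ → Continuous v₂ → (∀ s, |v₁ s| ≤ M) → (∀ s, |v₂ s| ≤ M) →
      (∀ s, |v₁ s - v₂ s| ≤ δ) → ∀ τ ∈ Set.Icc τ₀ (τ₀ + T),
      (Integrable fun k : Momentum => freq c ‖k‖ ^ (1 / 4 : ℝ) *
        |pertDensity (freq c ‖k‖) τ₀ v₁ τ - pertDensity (freq c ‖k‖) τ₀ v₂ τ|) ∧
      ∫ k : Momentum, freq c ‖k‖ ^ (1 / 4 : ℝ) *
        |pertDensity (freq c ‖k‖) τ₀ v₁ τ - pertDensity (freq c ‖k‖) τ₀ v₂ τ| ≤ C * δ := by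
  obtain ⟨C, hC0, hC⟩ := exists_integral_cosIntegral_le hc
  set A := ∫ k : Momentum, freq c ‖k‖ ^ (-(15 / 4 : ℝ)) with hA
  have hA0 : 0 ≤ A := integral_nonneg fun k => Real.rpow_nonneg (freq_pos hc _).le _
  refine ⟨C + 9 * M * A, by positivity, fun τ₀ T δ v₁ v₂ hT hT1 hs hv₁ hv₂ hM₁ hM₂ hδ τ hτ => ?_⟩
  have hδ0 : 0 ≤ δ := (abs_nonneg _).trans (hδ τ₀)
  obtain ⟨i1, i2⟩ := hC (fun s => v₁ s - v₂ s) δ τ₀ τ (hv₁.sub hv₂) hδ hτ.1 (by linarith [hτ.2])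
  have hp := integrable_freq_rpow_neg hc (p := 15 / 4) (by norm_num)
  have hdom := i1.add (hp.const_mul (9 * M * δ))
  have hf : Continuous fun k : Momentum => freq c ‖k‖ := (continuous_freq c).comp continuous_norm
  have hw : Continuous fun k : Momentum => freq c ‖k‖ ^ (1 / 4 : ℝ) :=
    hf.rpow_const fun k => Or.inl (freq_pos hc _).ne'
  have hcont : Continuous fun k : Momentum => freq c ‖k‖ ^ (1 / 4 : ℝ) *
      |pertDensity (freq c ‖k‖) τ₀ v₁ τ - pertDensity (freq c ‖k‖) τ₀ v₂ τ| :=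
    hw.mul ((continuous_pertDensity_freq hc hv₁ hM₁ hs hτ).sub
      (continuous_pertDensity_freq hc hv₂ hM₂ hs hτ)).abs
  have hbound : ∀ k : Momentum, freq c ‖k‖ ^ (1 / 4 : ℝ) *
      |pertDensity (freq c ‖k‖) τ₀ v₁ τ - pertDensity (freq c ‖k‖) τ₀ v₂ τ| ≤
      freq c ‖k‖ ^ (-(11 / 4 : ℝ)) * |cosIntegral (fun s => v₁ s - v₂ s) τ₀ τ (freq c ‖k‖)| +
        9 * M * δ * freq c ‖k‖ ^ (-(15 / 4 : ℝ)) := by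
    intro k
    -- Since `κ ≥ c`, one smallness condition at `c` serves all momenta. The weight turns `κ⁻³` and
    -- `κ⁻⁴` into `κ^(-11/4)` and `κ^(-15/4)`.
    have hcκ : c ≤ freq c ‖k‖ := le_freq _
    set κ := freq c ‖k‖
    have hκ : 0 < κ := hc.trans_le hcκ
    have h := abs_pertDensity_sub_le hκ hT hv₁ hv₂ hM₁ hM₂ hδ (hs.trans hcκ) τ hτ
    set F := |cosIntegral (fun s => v₁ s - v₂ s) τ₀ τ κ|
    have hF : 0 ≤ F := abs_nonneg _
    have e1 : κ ^ (-(11 / 4 : ℝ)) = κ ^ (1 / 4 : ℝ) / κ ^ 3 := by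
      rw [← Real.rpow_natCast κ 3, ← Real.rpow_sub hκ]; norm_num
    have e2 : κ ^ (-(15 / 4 : ℝ)) = κ ^ (1 / 4 : ℝ) / κ ^ 4 := by
      rw [← Real.rpow_natCast κ 4, ← Real.rpow_sub hκ]; norm_num
    have hw0 : 0 ≤ κ ^ (1 / 4 : ℝ) := Real.rpow_nonneg hκ.le _
    rw [e1, e2]
    refine (mul_le_mul_of_nonneg_left h hw0).trans ?_
    rw [mul_add]
    refine add_le_add ?_ ?_
    · rw [← mul_assoc]
      refine mul_le_mul_of_nonneg_right ?_ hF
      rw [mul_one_div]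
      gcongr
      nlinarith [pow_pos hκ 3]
    · rw [mul_div_assoc', mul_div_assoc', ← mul_assoc]
      refine div_le_div_of_nonneg_right ?_ (by positivity)
      have hT3 : T ^ 3 ≤ 1 := pow_le_one₀ hT hT1
      have : 0 ≤ κ ^ (1 / 4 : ℝ) * (9 * δ * M) := by positivity
      nlinarith
  have hint := hdom.mono' hcont.aestronglyMeasurable (Filter.Eventually.of_forall fun k => by
    rw [Real.norm_of_nonneg (mul_nonneg (Real.rpow_nonneg (freq_pos hc _).le _) (abs_nonneg _))]
    exact hbound k)
  refine ⟨hint, (integral_mono hint hdom hbound).trans ?_⟩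
  simp only [Pi.add_apply]
  rw [integral_add i1 (hp.const_mul _), integral_const_mul]
  nlinarith

/-- The momentum integral of the mode density. -/
noncomputable def densityIntegral (c τ₀ : ℝ) (v : ℝ → ℝ) (τ : ℝ) : ℝ :=
  ∫ k : Momentum, pertDensity (freq c ‖k‖) τ₀ v τ

theorem integrable_of_integrable_weight {c : ℝ} (hc : 0 < c) {D : Momentum → ℝ}
    (hD : Continuous D) (h : Integrable fun k : Momentum => freq c ‖k‖ ^ (1 / 4 : ℝ) * |D k|) :
    Integrable D ∧ |∫ k, D k| ≤
      c ^ (-(1 / 4 : ℝ)) * ∫ k : Momentum, freq c ‖k‖ ^ (1 / 4 : ℝ) * |D k| := by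
  have hb : ∀ k, ‖D k‖ ≤ c ^ (-(1 / 4 : ℝ)) * (freq c ‖k‖ ^ (1 / 4 : ℝ) * |D k|) := by
    intro k
    rw [← mul_assoc, Real.norm_eq_abs, Real.rpow_neg hc.le]
    refine le_mul_of_one_le_left (abs_nonneg _) ?_
    rw [inv_mul_eq_div, one_le_div (Real.rpow_pos_of_pos hc _)]
    exact Real.rpow_le_rpow hc.le (le_freq _) (by norm_num)
  refine ⟨(h.const_mul _).mono' hD.aestronglyMeasurable (Filter.Eventually.of_forall hb), ?_⟩
  rw [← integral_const_mul]
  exact norm_integral_le_of_norm_le (h.const_mul _) (Filter.Eventually.of_forall hb)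

/-- Outside the ball the weight is at least `n^(1/4)`, so a weighted bound gives a quantitative
tail. -/
theorem abs_integral_compl_ball_le {c : ℝ} (hc : 0 < c) {D : Momentum → ℝ} {n : ℝ} (hn : 0 < n)
    (h : Integrable fun k : Momentum => freq c ‖k‖ ^ (1 / 4 : ℝ) * |D k|) :
    |∫ k in (Metric.closedBall 0 n)ᶜ, D k| ≤
      n ^ (-(1 / 4 : ℝ)) * ∫ k : Momentum, freq c ‖k‖ ^ (1 / 4 : ℝ) * |D k| := by
  have hnn : ∀ k : Momentum, 0 ≤ n ^ (-(1 / 4 : ℝ)) * (freq c ‖k‖ ^ (1 / 4 : ℝ) * |D k|) :=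
    fun k => mul_nonneg (Real.rpow_nonneg hn.le _)
      (mul_nonneg (Real.rpow_nonneg (freq_pos hc _).le _) (abs_nonneg _))
  rw [← integral_const_mul]
  have hle : ‖∫ k in (Metric.closedBall 0 n)ᶜ, D k‖ ≤ ∫ k in (Metric.closedBall (0 : Momentum) n)ᶜ,
      n ^ (-(1 / 4 : ℝ)) * (freq c ‖k‖ ^ (1 / 4 : ℝ) * |D k|) := by
    refine norm_integral_le_of_norm_le (h.const_mul _).integrableOn
      ((ae_restrict_iff' Metric.isClosed_closedBall.measurableSet.compl).2
        (Filter.Eventually.of_forall fun k hk => ?_))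
    have hk' : n ≤ ‖k‖ := by
      simp only [Set.mem_compl_iff, Metric.mem_closedBall, dist_zero_right, not_le] at hk
      exact hk.le
    rw [← mul_assoc, Real.norm_eq_abs, Real.rpow_neg hn.le]
    refine le_mul_of_one_le_left (abs_nonneg _) ?_
    rw [inv_mul_eq_div, one_le_div (Real.rpow_pos_of_pos hn _)]
    exact Real.rpow_le_rpow hn.le (hk'.trans (le_freq_left _ _)) (by norm_num)
  exact hle.trans (setIntegral_le_integral (h.const_mul _) (Filter.Eventually.of_forall hnn))

theorem exists_densityIntegral_bounds {c M : ℝ} (hc : 0 < c) (hM : 0 ≤ M) :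
    ∃ C : ℝ, 0 ≤ C ∧ ∀ (τ₀ T : ℝ), 0 ≤ T → T ≤ 1 → 6 * M * T ^ 2 ≤ c →
      (∀ v : ℝ → ℝ, Continuous v → (∀ s, |v s| ≤ M) →
        (∀ τ ∈ Set.Icc τ₀ (τ₀ + T),
          Integrable fun k : Momentum => pertDensity (freq c ‖k‖) τ₀ v τ) ∧
        ContinuousOn (densityIntegral c τ₀ v) (Set.Icc τ₀ (τ₀ + T)) ∧
        ∀ τ ∈ Set.Icc τ₀ (τ₀ + T), |densityIntegral c τ₀ v τ| ≤ C * M) ∧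
      ∀ (δ : ℝ) (v₁ v₂ : ℝ → ℝ), Continuous v₁ → Continuous v₂ → (∀ s, |v₁ s| ≤ M) →
        (∀ s, |v₂ s| ≤ M) → (∀ s, |v₁ s - v₂ s| ≤ δ) → ∀ τ ∈ Set.Icc τ₀ (τ₀ + T),
        |densityIntegral c τ₀ v₁ τ - densityIntegral c τ₀ v₂ τ| ≤ C * δ := by
  obtain ⟨C, hC0, hC⟩ := exists_integral_pertDensity_sub_le hc hM
  have hcw : 0 ≤ c ^ (-(1 / 4 : ℝ)) := Real.rpow_nonneg hc.le _
  refine ⟨c ^ (-(1 / 4 : ℝ)) * C, by positivity, fun τ₀ T hT hT1 hs => ?_⟩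
  have single : ∀ v : ℝ → ℝ, Continuous v → (∀ s, |v s| ≤ M) → ∀ τ ∈ Set.Icc τ₀ (τ₀ + T),
      (Integrable fun k : Momentum => freq c ‖k‖ ^ (1 / 4 : ℝ) *
        |pertDensity (freq c ‖k‖) τ₀ v τ|) ∧
      ∫ k : Momentum, freq c ‖k‖ ^ (1 / 4 : ℝ) * |pertDensity (freq c ‖k‖) τ₀ v τ| ≤ C * M := by
    intro v hv hvM τ hτ
    have h := hC τ₀ T M v (fun _ => 0) hT hT1 hs hv continuous_const hvM (by simpa using hM)
      (by simpa using hvM) τ hτ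
    simpa only [pertDensity_zero (freq_pos hc _) hτ.1, sub_zero] using h
  have int : ∀ v : ℝ → ℝ, Continuous v → (∀ s, |v s| ≤ M) → ∀ τ ∈ Set.Icc τ₀ (τ₀ + T),
      Integrable fun k : Momentum => pertDensity (freq c ‖k‖) τ₀ v τ := fun v hv hvM τ hτ =>
    (integrable_of_integrable_weight hc (continuous_pertDensity_freq hc hv hvM hs hτ)
      (single v hv hvM τ hτ).1).1
  refine ⟨fun v hv hvM => ⟨int v hv hvM, ?_, fun τ hτ => ?_⟩, ?_⟩
  -- No `τ`-independent integrable majorant on all of `ℝ³` is at hand from Plancherel. Instead the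
  -- momentum is cut off, with tails uniform in `τ`; on each ball a constant majorant suffices.
  · have hunif : TendstoUniformlyOn
        (fun (n : ℕ) τ => ∫ k in Metric.closedBall (0 : Momentum) (n + 1),
          pertDensity (freq c ‖k‖) τ₀ v τ)
        (densityIntegral c τ₀ v) Filter.atTop (Set.Icc τ₀ (τ₀ + T)) := by
      have hlim : Filter.Tendsto (fun n : ℕ => ((n : ℝ) + 1) ^ (-(1 / 4 : ℝ)) * (C * M))
          Filter.atTop (nhds 0) := by
        have h1 : Filter.Tendsto (fun n : ℕ => (n : ℝ) + 1) Filter.atTop Filter.atTop :=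
          Filter.tendsto_atTop_add_const_right _ _ tendsto_natCast_atTop_atTop
        simpa using ((tendsto_rpow_neg_atTop (show (0 : ℝ) < 1 / 4 by norm_num)).comp
          h1).mul_const (C * M)
      rw [Metric.tendstoUniformlyOn_iff]
      intro ε hε
      filter_upwards [hlim.eventually (gt_mem_nhds hε)] with n hn τ hτ
      have hn1 : (0 : ℝ) < n + 1 := by positivity
      have hsplit := integral_add_compl (s := Metric.closedBall (0 : Momentum) (n + 1))
        Metric.isClosed_closedBall.measurableSet (int v hv hvM τ hτ)
      have htail := abs_integral_compl_ball_le hc hn1 (single v hv hvM τ hτ).1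
      rw [Real.dist_eq, densityIntegral, ← hsplit, add_sub_cancel_left]
      refine (htail.trans ?_).trans_lt hn
      exact mul_le_mul_of_nonneg_left (single v hv hvM τ hτ).2 (Real.rpow_nonneg hn1.le _)
    refine hunif.continuousOn (Filter.Frequently.of_forall fun n => ?_)
    refine continuousOn_of_dominated
      (bound := fun _ => 1 / (4 * c ^ 3) * (M * T) + 9 * M * M * T ^ 3 / c ^ 4)
      (fun τ hτ => (continuous_pertDensity_freq hc hv hvM hs hτ).aestronglyMeasurable)
      (fun τ hτ => Filter.Eventually.of_forall fun k => ?_) ?_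
      (Filter.Eventually.of_forall fun k => continuousOn_pertDensity (freq_pos hc _) hv hvM
        (hs.trans (le_freq _)))
    · refine (abs_pertDensity_le (freq_pos hc _) hT hv hvM (hs.trans (le_freq _)) τ hτ).trans ?_
      have := le_freq (c := c) ‖k‖
      gcongr
    · exact integrableOn_const (isCompact_closedBall _ _).measure_lt_top.ne
  · refine (integrable_of_integrable_weight hc (continuous_pertDensity_freq hc hv hvM hs hτ)
      (single v hv hvM τ hτ).1).2.trans ?_
    rw [mul_assoc]
    exact mul_le_mul_of_nonneg_left (single v hv hvM τ hτ).2 hcw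
  · intro δ v₁ v₂ hv₁ hv₂ hM₁ hM₂ hδ τ hτ
    have h := hC τ₀ T δ v₁ v₂ hT hT1 hs hv₁ hv₂ hM₁ hM₂ hδ τ hτ
    rw [densityIntegral, densityIntegral,
      ← integral_sub (int v₁ hv₁ hM₁ τ hτ) (int v₂ hv₂ hM₂ τ hτ), mul_assoc]
    exact (integrable_of_integrable_weight hc ((continuous_pertDensity_freq hc hv₁ hM₁ hs hτ).sub
      (continuous_pertDensity_freq hc hv₂ hM₂ hs hτ)) h.1).2.trans
      (mul_le_mul_of_nonneg_left h.2 hcw)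

/-! ### Picard iteration -/

/-- Banach's fixed point theorem: `Mf * T ≤ r` keeps the ball invariant and `L * T ≤ 1/2` makes the
integral operator a contraction. `f H` may depend on `H` nonlocally. -/
theorem existsUnique_picard {τ₀ T r Mf L : ℝ} (hT : 0 ≤ T) (hr : 0 ≤ r) (H₀ : ℝ)
    (f : C(Set.Icc τ₀ (τ₀ + T), ℝ) → ℝ → ℝ) {U : Set C(Set.Icc τ₀ (τ₀ + T), ℝ)}
    (hU : U = Metric.closedBall (ContinuousMap.const _ H₀) r)
    (hcont : ∀ H ∈ U, ContinuousOn (f H) (Set.Icc τ₀ (τ₀ + T)))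
    (hbound : ∀ H ∈ U, ∀ τ ∈ Set.Icc τ₀ (τ₀ + T), |f H τ| ≤ Mf)
    (hlip : ∀ H₁ ∈ U, ∀ H₂ ∈ U, ∀ τ ∈ Set.Icc τ₀ (τ₀ + T),
      |f H₁ τ - f H₂ τ| ≤ L * dist H₁ H₂)
    (hMf : Mf * T ≤ r) (hL : L * T ≤ 1 / 2) :
    ∃! H : C(Set.Icc τ₀ (τ₀ + T), ℝ), H ∈ U ∧
      ∀ τ : Set.Icc τ₀ (τ₀ + T), H τ = H₀ + ∫ η in τ₀..(τ : ℝ), f H η := by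
  have hle : τ₀ ≤ τ₀ + T := by linarith
  set F : C(Set.Icc τ₀ (τ₀ + T), ℝ) → ℝ → ℝ := fun H =>
    Set.IccExtend hle (Set.domRestrict _ (f H)) with hF
  have hFc : ∀ H ∈ U, Continuous (F H) := fun H hH =>
    (continuousOn_iff_continuous_domRestrict.1 (hcont H hH)).Icc_extend'
  have hFe : ∀ H, ∀ τ ∈ Set.Icc τ₀ (τ₀ + T), F H τ = f H τ := fun H τ hτ => by
    rw [hF]
    simp only [Set.IccExtend_of_mem _ _ hτ, Set.domRestrict_apply]
  have hint : ∀ H, ∀ τ ∈ Set.Icc τ₀ (τ₀ + T), primitive τ₀ (F H) τ = ∫ η in τ₀..τ, f H η := by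
    intro H τ hτ
    refine intervalIntegral.integral_congr fun η hη => ?_
    rw [Set.uIcc_of_le hτ.1] at hη
    exact hFe H η ⟨hη.1, hη.2.trans hτ.2⟩
  have hmem : ∀ H : U, (⟨fun τ => H₀ + primitive τ₀ (F H) τ,
      by have := hFc H H.2; fun_prop⟩ : C(Set.Icc τ₀ (τ₀ + T), ℝ)) ∈ U := by
    intro H
    refine (Set.ext_iff.1 hU _).2 ?_
    rw [Metric.mem_closedBall, ContinuousMap.dist_le hr]
    intro τ
    rw [ContinuousMap.coe_mk, ContinuousMap.const_apply, Real.dist_eq, add_sub_cancel_left]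
    refine (abs_primitive_le (fun s hs => ?_) τ.2).trans hMf
    rw [hFe _ s hs]
    exact hbound H H.2 s hs
  set op : U → U := fun H => ⟨_, hmem H⟩ with hop
  have hopa : ∀ (H : U) (τ : Set.Icc τ₀ (τ₀ + T)), (op H).1 τ = H₀ + ∫ η in τ₀..(τ : ℝ), f H η :=
    fun H τ => by rw [← hint H τ τ.2]; rfl
  have hcontr : ContractingWith (1 / 2) op := by
    refine ⟨by norm_num, LipschitzWith.of_dist_le_mul fun H₁ H₂ => ?_⟩
    rw [Subtype.dist_eq, Subtype.dist_eq, ContinuousMap.dist_le (by positivity)]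
    intro τ
    have hsub : primitive τ₀ (fun s => F H₁ s - F H₂ s) τ =
        primitive τ₀ (F H₁) τ - primitive τ₀ (F H₂) τ :=
      intervalIntegral.integral_sub ((hFc _ H₁.2).intervalIntegrable _ _)
        ((hFc _ H₂.2).intervalIntegrable _ _)
    have e : (op H₁).1 τ - (op H₂).1 τ = primitive τ₀ (fun s => F H₁ s - F H₂ s) τ := by
      rw [hsub, hop]
      simp
    rw [Real.dist_eq, e]
    refine (abs_primitive_le (M := L * dist (H₁ : C(Set.Icc τ₀ (τ₀ + T), ℝ)) H₂)
      (fun s hs => ?_) τ.2).trans ?_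
    · rw [hFe _ s hs, hFe _ s hs]
      exact hlip _ H₁.2 _ H₂.2 s hs
    · have := dist_nonneg (x := (H₁ : C(Set.Icc τ₀ (τ₀ + T), ℝ))) (y := H₂)
      push_cast
      nlinarith
  have hclosed : IsClosed U := by rw [hU]; exact Metric.isClosed_closedBall
  have : CompleteSpace U := hclosed.completeSpace_coe
  have : Nonempty U := ⟨⟨ContinuousMap.const _ H₀, by
    rw [hU]; exact Metric.mem_closedBall_self hr⟩⟩
  refine ⟨(hcontr.fixedPoint op : U), ⟨(hcontr.fixedPoint op : U).2, fun τ => ?_⟩, ?_⟩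
  · have hfix := hcontr.fixedPoint_isFixedPt
    rw [← hopa, hfix.eq]
  · rintro H ⟨hH, hs⟩
    have hfix : Function.IsFixedPt op ⟨H, hH⟩ := by
      refine Subtype.ext (ContinuousMap.ext fun τ => ?_)
      rw [hopa]
      exact (hs τ).symm
    exact congrArg Subtype.val (hcontr.fixedPoint_unique hfix)

/-- `C¹` gives local Lipschitz bounds, and compactness makes them global on `K` without convexity.
-/
theorem exists_lipschitz_of_contDiffAt {E : Type*} [NormedAddCommGroup E] [NormedSpace ℝ E]
    {K : Set E} (hK : IsCompact K) {Φ : E → ℝ} (hΦ : ∀ p ∈ K, ContDiffAt ℝ 1 Φ p) :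
    ∃ L B : ℝ, 0 ≤ L ∧ 0 ≤ B ∧ (∀ p ∈ K, |Φ p| ≤ B) ∧
      ∀ p ∈ K, ∀ q ∈ K, |Φ p - Φ q| ≤ L * dist p q := by
  have hloc : LocallyLipschitzOn K Φ := fun p hp => by
    obtain ⟨C, t, ht, h⟩ := (hΦ p hp).exists_lipschitzOnWith
    exact ⟨C, t, mem_nhdsWithin_of_mem_nhds ht, h⟩
  obtain ⟨L, hL⟩ := hloc.exists_lipschitzOnWith_of_compact hK
  obtain ⟨B, hB⟩ := hK.exists_bound_of_continuousOn
    fun p hp => (hΦ p hp).continuousAt.continuousWithinAt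
  exact ⟨L, max B 0, L.2, le_max_right _ _, fun p hp => (hB p hp).trans (le_max_left _ _),
    fun p hp q hq => by rw [← Real.dist_eq]; exact hL.dist_le_mul p hp q hq⟩

/-! ### The scale factor and the integrand of the Friedmann equation -/

theorem initialFrequency_scaleFactor (m a₀ τ₀ : ℝ) (H : ℝ → ℝ) (k : ℝ) :
    initialFrequency m τ₀ (scaleFactor a₀ τ₀ H) k = freq (a₀ * m) k := by
  simp [initialFrequency, scaleFactor, freq, mul_pow]

theorem modeDensity_eq_pertDensity {m a₀ τ₀ τ₁ τ : ℝ} {H v : ℝ → ℝ}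
    (hv : ∀ η ∈ Set.Icc τ₀ τ₁, potential m τ₀ (scaleFactor a₀ τ₀ H) η = primitive τ₀ v η)
    (hτ : τ ∈ Set.Icc τ₀ τ₁) (k : ℝ) :
    modeDensity m τ₀ (scaleFactor a₀ τ₀ H) k τ = pertDensity (freq (a₀ * m) k) τ₀ v τ := by
  have h : mode m τ₀ (scaleFactor a₀ τ₀ H) k τ =
      pertSum (freq (a₀ * m) k) τ₀ (primitive τ₀ v) τ := by
    refine tsum_congr fun n => ?_
    rw [modeTerm_eq_pert, initialFrequency_scaleFactor, pert_congr hv n hτ]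
  rw [modeDensity, pertDensity, h, initialFrequency_scaleFactor, hv τ hτ]

/-- The denominator `1 - a₀ ∫ H`, the ratio `a₀ / a`. -/
noncomputable def redshift (a₀ τ₀ : ℝ) (H : ℝ → ℝ) (τ : ℝ) : ℝ := 1 - a₀ * primitive τ₀ H τ

theorem scaleFactor_eq (a₀ τ₀ : ℝ) (H : ℝ → ℝ) (τ : ℝ) :
    scaleFactor a₀ τ₀ H τ = a₀ * (redshift a₀ τ₀ H τ)⁻¹ := rfl

theorem continuous_redshift {H : ℝ → ℝ} (hH : Continuous H) (a₀ τ₀ : ℝ) :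
    Continuous (redshift a₀ τ₀ H) := by
  unfold redshift
  fun_prop

/-- The derivative of the potential as a function of `a₀ / a` and the Hubble function. -/
noncomputable def potentialRate (m a₀ : ℝ) (p : ℝ × ℝ) : ℝ :=
  2 * m ^ 2 * (a₀ * p.1⁻¹) ^ 3 * p.2

/-- From `(a₀/a)' = -a₀ H` follows `V' = 2 m² a³ H`, which involves `H` but not its derivative. -/
theorem potential_eq_primitive {m a₀ τ₀ τ : ℝ} {H v : ℝ → ℝ} (hH : Continuous H)
    (hv : Continuous v) (hτ : τ₀ ≤ τ)
    (hx : ∀ η ∈ Set.Icc τ₀ τ, redshift a₀ τ₀ H η ≠ 0)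
    (hve : ∀ η ∈ Set.Icc τ₀ τ, v η = potentialRate m a₀ (redshift a₀ τ₀ H η, H η)) :
    potential m τ₀ (scaleFactor a₀ τ₀ H) τ = primitive τ₀ v τ := by
  have hd : ∀ η ∈ Set.uIcc τ₀ τ,
      HasDerivAt (fun η => m ^ 2 * (a₀ * (redshift a₀ τ₀ H η)⁻¹) ^ 2) (v η) η := by
    intro η hη
    rw [Set.uIcc_of_le hτ] at hη
    have hx0 := hx η hη
    have hdx : HasDerivAt (redshift a₀ τ₀ H) (-(a₀ * H η)) η :=
      ((hasDerivAt_primitive hH τ₀ η).const_mul a₀).const_sub 1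
    refine ((((hdx.inv hx0).const_mul a₀).pow 2).const_mul (m ^ 2)).congr_deriv ?_
    rw [hve η hη, potentialRate]
    simp only [Nat.cast_ofNat, Nat.add_one_sub_one, pow_one, Pi.inv_apply]
    field_simp
  have h := intervalIntegral.integral_eq_sub_of_hasDerivAt hd (hv.intervalIntegrable _ _)
  rw [primitive, h, potential, scaleFactor_eq, scaleFactor_eq]
  ring

/-- The integrand of the Friedmann equation as a function of `a₀ / a`, the Hubble function and the
momentum integral. -/
noncomputable def friedmannRate (G Λ m ℓ a₀ : ℝ) (p : (ℝ × ℝ) × ℝ) : ℝ :=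
  a₀ * p.1.1⁻¹ / (criticalHubble G ^ 2 - p.1.2 ^ 2) *
    (p.1.2 ^ 4 - 2 * criticalHubble G ^ 2 * p.1.2 ^ 2 - 15 / 2 * m ^ 4 +
      240 * Real.pi ^ 2 * (m ^ 2 * (1 / ((2 * Real.pi) ^ 3 * (a₀ * p.1.1⁻¹) ^ 2) * p.2 +
        m ^ 2 / (4 * Real.pi) ^ 2 *
          (1 / 2 - (a₀ / (a₀ * p.1.1⁻¹)) ^ 2 + 2 * Real.log (a₀ / (a₀ * p.1.1⁻¹)) +
            2 * Real.log (Real.exp Real.eulerMascheroniConstant * m * ℓ / Real.sqrt 2))) + 4 * Λ))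

theorem friedmannIntegrand_eq {G Λ m ℓ a₀ τ₀ τ₁ τ : ℝ} {H v : ℝ → ℝ}
    (hv : ∀ η ∈ Set.Icc τ₀ τ₁, potential m τ₀ (scaleFactor a₀ τ₀ H) η = primitive τ₀ v η)
    (hτ : τ ∈ Set.Icc τ₀ τ₁) :
    friedmannIntegrand G Λ m ℓ a₀ τ₀ H τ =
      friedmannRate G Λ m ℓ a₀
        ((redshift a₀ τ₀ H τ, H τ), densityIntegral (a₀ * m) τ₀ v τ) := by
  have h0 : scaleFactor a₀ τ₀ H τ₀ = a₀ := by simp [scaleFactor]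
  simp only [friedmannIntegrand, wickSquare, h0, scaleFactor_eq, friedmannRate, densityIntegral,
    ← modeDensity_eq_pertDensity hv hτ]

theorem contDiffAt_potentialRate (m a₀ : ℝ) {p : ℝ × ℝ} (hp : p.1 ≠ 0) :
    ContDiffAt ℝ 1 (potentialRate m a₀) p := by
  unfold potentialRate
  fun_prop (disch := assumption)

theorem contDiffAt_friedmannRate (G Λ m ℓ : ℝ) {a₀ : ℝ} (ha₀ : 0 < a₀) {p : (ℝ × ℝ) × ℝ}
    (hp : 0 < p.1.1) (hh : |p.1.2| < criticalHubble G) :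
    ContDiffAt ℝ 1 (friedmannRate G Λ m ℓ a₀) p := by
  have h1 : criticalHubble G ^ 2 - p.1.2 ^ 2 ≠ 0 := by
    have := sq_lt_sq' (abs_lt.1 hh).1 (abs_lt.1 hh).2
    linarith
  have h2 : p.1.1 ≠ 0 := hp.ne'
  have h3 : (2 * Real.pi) ^ 3 * (a₀ * p.1.1⁻¹) ^ 2 ≠ 0 := by
    have := Real.pi_pos; positivity
  have h4 : a₀ * p.1.1⁻¹ ≠ 0 := by positivity
  have h5 : a₀ / (a₀ * p.1.1⁻¹) ≠ 0 := by positivity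
  unfold friedmannRate
  fun_prop (disch := assumption)

/-- The derivative of the potential along `H`, extended by constants outside `[τ₀, τ₁]`. -/
noncomputable def potentialRateExtend (m a₀ : ℝ) {τ₀ τ₁ : ℝ} (h : τ₀ ≤ τ₁)
    (H : C(Set.Icc τ₀ τ₁, ℝ)) : ℝ → ℝ :=
  Set.IccExtend h fun t : Set.Icc τ₀ τ₁ =>
    potentialRate m a₀ (redshift a₀ τ₀ (Set.IccExtend h H) t, H t)

theorem redshift_mem_Icc {a₀ ρ τ₀ T τ : ℝ} {H : ℝ → ℝ} (ha₀ : 0 < a₀) (hH : ∀ s, |H s| ≤ ρ)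
    (hT : a₀ * ρ * T ≤ 1 / 2) (hτ : τ ∈ Set.Icc τ₀ (τ₀ + T)) :
    redshift a₀ τ₀ H τ ∈ Set.Icc (1 / 2 : ℝ) (3 / 2) := by
  have h := abs_primitive_le (fun s _ => hH s) hτ
  have h1 : |a₀ * primitive τ₀ H τ| ≤ 1 / 2 := by
    rw [abs_mul, abs_of_pos ha₀]
    nlinarith
  rw [abs_le] at h1
  exact ⟨by rw [redshift]; linarith [h1.2], by rw [redshift]; linarith [h1.1]⟩

theorem abs_redshift_sub_le {a₀ δ τ₀ T τ : ℝ} {H₁ H₂ : ℝ → ℝ} (ha₀ : 0 < a₀)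
    (hH₁ : Continuous H₁) (hH₂ : Continuous H₂) (hδ : ∀ s, |H₁ s - H₂ s| ≤ δ) (hT : T ≤ 1)
    (hτ : τ ∈ Set.Icc τ₀ (τ₀ + T)) :
    |redshift a₀ τ₀ H₁ τ - redshift a₀ τ₀ H₂ τ| ≤ a₀ * δ := by
  have hδ0 : 0 ≤ δ := (abs_nonneg _).trans (hδ τ)
  have h := abs_primitive_le (v := fun s => H₁ s - H₂ s) (fun s _ => hδ s) hτ
  have e : primitive τ₀ (fun s => H₁ s - H₂ s) τ = primitive τ₀ H₁ τ - primitive τ₀ H₂ τ :=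
    intervalIntegral.integral_sub (hH₁.intervalIntegrable _ _) (hH₂.intervalIntegrable _ _)
  have e2 : redshift a₀ τ₀ H₁ τ - redshift a₀ τ₀ H₂ τ =
      -(a₀ * primitive τ₀ (fun s => H₁ s - H₂ s) τ) := by
    rw [e, redshift, redshift]; ring
  rw [e2, abs_neg, abs_mul, abs_of_pos ha₀]
  refine mul_le_mul_of_nonneg_left (h.trans ?_) ha₀.le
  nlinarith

theorem exists_constants (G Λ m ℓ : ℝ) (hm : 0 < m) {a₀ ρ : ℝ} (ha₀ : 0 < a₀)
    (hρc : ρ < criticalHubble G) :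
    ∃ Mv Mf L : ℝ, 0 ≤ Mv ∧ 0 ≤ Mf ∧ 0 ≤ L ∧ ∀ (τ₀ T : ℝ) (hT : 0 ≤ T), T ≤ 1 →
      a₀ * ρ * T ≤ 1 / 2 → 6 * Mv * T ^ 2 ≤ a₀ * m →
      (∀ H : C(Set.Icc τ₀ (τ₀ + T), ℝ), ‖H‖ ≤ ρ →
        (∀ τ ∈ Set.Icc τ₀ (τ₀ + T), 1 / 2 ≤ redshift a₀ τ₀
          (Set.IccExtend (le_add_of_nonneg_right hT) H) τ) ∧
        (∀ τ ∈ Set.Icc τ₀ (τ₀ + T), WickSquareFinite m τ₀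
          (scaleFactor a₀ τ₀ (Set.IccExtend (le_add_of_nonneg_right hT) H)) τ) ∧
        ContinuousOn (friedmannIntegrand G Λ m ℓ a₀ τ₀
          (Set.IccExtend (le_add_of_nonneg_right hT) H)) (Set.Icc τ₀ (τ₀ + T)) ∧
        ∀ τ ∈ Set.Icc τ₀ (τ₀ + T), |friedmannIntegrand G Λ m ℓ a₀ τ₀
          (Set.IccExtend (le_add_of_nonneg_right hT) H) τ| ≤ Mf) ∧
      ∀ H₁ H₂ : C(Set.Icc τ₀ (τ₀ + T), ℝ), ‖H₁‖ ≤ ρ → ‖H₂‖ ≤ ρ →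
        ∀ τ ∈ Set.Icc τ₀ (τ₀ + T),
          |friedmannIntegrand G Λ m ℓ a₀ τ₀ (Set.IccExtend (le_add_of_nonneg_right hT) H₁) τ -
            friedmannIntegrand G Λ m ℓ a₀ τ₀ (Set.IccExtend (le_add_of_nonneg_right hT) H₂) τ| ≤
              L * dist H₁ H₂ := by
  set K : Set (ℝ × ℝ) := Set.Icc (1 / 2) (3 / 2) ×ˢ Set.Icc (-ρ) ρ with hK
  have hKc : IsCompact K := isCompact_Icc.prod isCompact_Icc
  have hc : 0 < a₀ * m := mul_pos ha₀ hm
  obtain ⟨Lv, Mv, hLv, hMv, hvb, hvl⟩ := exists_lipschitz_of_contDiffAt hKc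
    (Φ := potentialRate m a₀) fun p hp => contDiffAt_potentialRate m a₀ (by
      have := hp.1.1; linarith)
  -- The order avoids circularity: the box `K` fixes `Mv`, which fixes `C` and hence the range of
  -- the momentum integral, over which `friedmannRate` is then bounded. None of this involves `τ₀`
  -- or `T`.
  obtain ⟨C, hC, hJ⟩ := exists_densityIntegral_bounds hc hMv
  obtain ⟨Lf, Mf, hLf, hMf, hfb, hfl⟩ := exists_lipschitz_of_contDiffAt
    (hKc.prod (isCompact_Icc (a := -(C * Mv)) (b := C * Mv)))
    (Φ := friedmannRate G Λ m ℓ a₀) fun p hp => contDiffAt_friedmannRate G Λ m ℓ ha₀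
      (by have := hp.1.1.1; linarith) ((abs_le.2 hp.1.2).trans_lt hρc)
  -- The summands dominate the Lipschitz constants of `H`, of `a₀ / a` and of the momentum integral;
  -- `1 + a₀` dominates the maximum in the product metric.
  refine ⟨Mv, Mf, Lf * (1 + a₀ + C * (Lv * (1 + a₀))), hMv, hMf, by positivity,
    fun τ₀ T hT hT1 hTρ hTv => ?_⟩
  have hle : τ₀ ≤ τ₀ + T := le_add_of_nonneg_right hT
  obtain ⟨hJ1, hJ2⟩ := hJ τ₀ T hT hT1 hTv
  have hHc : ∀ H : C(Set.Icc τ₀ (τ₀ + T), ℝ), Continuous (Set.IccExtend hle H) :=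
    fun H => H.continuous.Icc_extend'
  have hHe : ∀ (H : C(Set.Icc τ₀ (τ₀ + T), ℝ)) (t : Set.Icc τ₀ (τ₀ + T)),
      Set.IccExtend hle H t = H t := fun H t => Set.IccExtend_val _ _ _
  have hHb : ∀ H : C(Set.Icc τ₀ (τ₀ + T), ℝ), ‖H‖ ≤ ρ → ∀ s, |Set.IccExtend hle H s| ≤ ρ :=
    fun H hH s => (H.norm_coe_le_norm _).trans hH
  have hK1 : ∀ H : C(Set.Icc τ₀ (τ₀ + T), ℝ), ‖H‖ ≤ ρ → ∀ t : Set.Icc τ₀ (τ₀ + T),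
      (redshift a₀ τ₀ (Set.IccExtend hle H) t, H t) ∈ K := fun H hH t =>
    ⟨redshift_mem_Icc ha₀ (hHb H hH) hTρ t.2, abs_le.1 ((H.norm_coe_le_norm t).trans hH)⟩
  have hvc : ∀ H : C(Set.Icc τ₀ (τ₀ + T), ℝ), ‖H‖ ≤ ρ →
      Continuous (potentialRateExtend m a₀ hle H) := by
    intro H hH
    refine Continuous.Icc_extend' (continuous_iff_continuousAt.2 fun t => ?_)
    refine ContinuousAt.comp (g := potentialRate m a₀)
      (f := fun t : Set.Icc τ₀ (τ₀ + T) => (redshift a₀ τ₀ (Set.IccExtend hle H) t, H t)) ?_ ?_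
    · refine (contDiffAt_potentialRate m a₀ ?_).continuousAt
      have := (hK1 H hH t).1.1
      simp only at this ⊢
      linarith
    · exact (((continuous_redshift (hHc H) a₀ τ₀).comp continuous_subtype_val).prodMk
        H.continuous).continuousAt
  have hvM : ∀ H : C(Set.Icc τ₀ (τ₀ + T), ℝ), ‖H‖ ≤ ρ →
      ∀ s, |potentialRateExtend m a₀ hle H s| ≤ Mv := fun H hH s => hvb _ (hK1 H hH _)
  have hpot : ∀ H : C(Set.Icc τ₀ (τ₀ + T), ℝ), ‖H‖ ≤ ρ → ∀ η ∈ Set.Icc τ₀ (τ₀ + T),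
      potential m τ₀ (scaleFactor a₀ τ₀ (Set.IccExtend hle H)) η =
        primitive τ₀ (potentialRateExtend m a₀ hle H) η := by
    intro H hH η hη
    refine potential_eq_primitive (hHc H) (hvc H hH) hη.1 (fun s hs => ?_) fun s hs => ?_
    · have := (redshift_mem_Icc ha₀ (hHb H hH) hTρ
        (show s ∈ Set.Icc τ₀ (τ₀ + T) from ⟨hs.1, hs.2.trans hη.2⟩)).1
      linarith
    · have hs' : s ∈ Set.Icc τ₀ (τ₀ + T) := ⟨hs.1, hs.2.trans hη.2⟩
      rw [potentialRateExtend, Set.IccExtend_of_mem _ _ hs', Set.IccExtend_of_mem _ _ hs']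
  have hf : ∀ H : C(Set.Icc τ₀ (τ₀ + T), ℝ), ‖H‖ ≤ ρ → ∀ τ ∈ Set.Icc τ₀ (τ₀ + T),
      friedmannIntegrand G Λ m ℓ a₀ τ₀ (Set.IccExtend hle H) τ = friedmannRate G Λ m ℓ a₀
        ((redshift a₀ τ₀ (Set.IccExtend hle H) τ, Set.IccExtend hle H τ),
          densityIntegral (a₀ * m) τ₀ (potentialRateExtend m a₀ hle H) τ) :=
    fun H hH τ hτ => friedmannIntegrand_eq (hpot H hH) hτ
  have hK2 : ∀ H : C(Set.Icc τ₀ (τ₀ + T), ℝ), ‖H‖ ≤ ρ → ∀ τ ∈ Set.Icc τ₀ (τ₀ + T),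
      ((redshift a₀ τ₀ (Set.IccExtend hle H) τ, Set.IccExtend hle H τ),
        densityIntegral (a₀ * m) τ₀ (potentialRateExtend m a₀ hle H) τ) ∈
        K ×ˢ Set.Icc (-(C * Mv)) (C * Mv) := fun H hH τ hτ =>
    ⟨⟨redshift_mem_Icc ha₀ (hHb H hH) hTρ hτ, abs_le.1 (hHb H hH τ)⟩,
      abs_le.1 ((hJ1 _ (hvc H hH) (hvM H hH)).2.2 τ hτ)⟩
  refine ⟨fun H hH => ⟨fun τ hτ => (redshift_mem_Icc ha₀ (hHb H hH) hTρ hτ).1,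
    fun τ hτ => ⟨fun k => ?_, ?_⟩, ?_, fun τ hτ => ?_⟩, fun H₁ H₂ hH₁ hH₂ τ hτ => ?_⟩
  · simp only [modeTerm_eq_pert, initialFrequency_scaleFactor]
    refine summable_pert (T := T) (K := Mv * T) (freq_pos hc k) (fun η hη => ?_) ?_ hτ
    · rw [hpot H hH η hη]
      exact abs_primitive_le (fun s _ => hvM H hH s) hη
    · nlinarith [le_freq (c := a₀ * m) k, mul_nonneg hMv (sq_nonneg T)]
  · simp only [modeDensity_eq_pertDensity (hpot H hH) hτ]
    exact (hJ1 _ (hvc H hH) (hvM H hH)).1 τ hτ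
  · refine ContinuousOn.congr (fun τ hτ => ?_) (hf H hH)
    have hmem := hK2 H hH τ hτ
    refine ContinuousAt.comp_continuousWithinAt (g := friedmannRate G Λ m ℓ a₀)
      (f := fun τ => ((redshift a₀ τ₀ (Set.IccExtend hle H) τ, Set.IccExtend hle H τ),
        densityIntegral (a₀ * m) τ₀ (potentialRateExtend m a₀ hle H) τ)) ?_ ?_
    · refine (contDiffAt_friedmannRate G Λ m ℓ ha₀ ?_
        ((hHb H hH τ).trans_lt hρc)).continuousAt
      exact lt_of_lt_of_le (by norm_num) hmem.1.1.1
    · exact (((continuous_redshift (hHc H) a₀ τ₀).prodMk (hHc H)).continuousWithinAt).prodMk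
        ((hJ1 _ (hvc H hH) (hvM H hH)).2.1 τ hτ)
  · rw [hf H hH τ hτ]
    exact hfb _ (hK2 H hH τ hτ)
  · rw [hf H₁ hH₁ τ hτ, hf H₂ hH₂ τ hτ]
    refine (hfl _ (hK2 H₁ hH₁ τ hτ) _ (hK2 H₂ hH₂ τ hτ)).trans ?_
    rw [mul_assoc]
    refine mul_le_mul_of_nonneg_left ?_ hLf
    set δ := dist H₁ H₂ with hδ
    have hδ0 : 0 ≤ δ := dist_nonneg
    have hd : ∀ t, |H₁ t - H₂ t| ≤ δ := fun t => by
      rw [← Real.dist_eq]; exact ContinuousMap.dist_apply_le_dist t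
    have hde : ∀ s, |Set.IccExtend hle H₁ s - Set.IccExtend hle H₂ s| ≤ δ := fun s => hd _
    have hx : ∀ s ∈ Set.Icc τ₀ (τ₀ + T), |redshift a₀ τ₀ (Set.IccExtend hle H₁) s -
        redshift a₀ τ₀ (Set.IccExtend hle H₂) s| ≤ a₀ * δ := fun s hs =>
      abs_redshift_sub_le ha₀ (hHc H₁) (hHc H₂) hde hT1 hs
    have hv : ∀ s, |potentialRateExtend m a₀ hle H₁ s - potentialRateExtend m a₀ hle H₂ s| ≤
        Lv * (1 + a₀) * δ := by
      intro s
      refine (hvl _ (hK1 H₁ hH₁ (Set.projIcc τ₀ (τ₀ + T) hle s)) _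
        (hK1 H₂ hH₂ (Set.projIcc τ₀ (τ₀ + T) hle s))).trans ?_
      rw [mul_assoc]
      refine mul_le_mul_of_nonneg_left ?_ hLv
      rw [Prod.dist_eq, max_le_iff, Real.dist_eq, Real.dist_eq]
      constructor
      · refine (hx _ (Set.projIcc τ₀ (τ₀ + T) hle s).2).trans ?_
        nlinarith
      · refine (hd _).trans ?_
        nlinarith
    have hj := hJ2 _ _ _ (hvc H₁ hH₁) (hvc H₂ hH₂) (hvM H₁ hH₁) (hvM H₂ hH₂) hv τ hτ
    have h1 : 0 ≤ C * (Lv * (1 + a₀)) * δ := by positivity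
    have h2 : 0 ≤ a₀ * δ := by positivity
    rw [Prod.dist_eq, Prod.dist_eq, max_le_iff, max_le_iff, Real.dist_eq, Real.dist_eq,
      Real.dist_eq]
    refine ⟨⟨(hx τ hτ).trans ?_, (hde τ).trans ?_⟩, hj.trans ?_⟩ <;> nlinarith

end SemiclassicalFriedmann

/-! ### Choice of the ball and of the length of the time interval. -/

theorem mainTheorem1 (G Λ m ℓ : ℝ) (hG : 0 < G) (hm : 0 < m) (hℓ : 0 < ℓ)
    (τ₀ a₀ H₀ : ℝ) (ha₀ : 0 < a₀)
    (hH₀ : |H₀| < SemiclassicalFriedmann.criticalHubble G) :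
    ∃ (τ₁ : ℝ) (h : τ₀ < τ₁) (U : Set C(Set.Icc τ₀ τ₁, ℝ)),
      IsClosed U ∧
      U ⊆ SemiclassicalFriedmann.candidates G a₀ τ₀ τ₁ ∧
      (∃ r : ℝ, 0 < r ∧
        Metric.closedBall (ContinuousMap.const (Set.Icc τ₀ τ₁) H₀) r ⊆ U) ∧
      (∀ H ∈ U, SemiclassicalFriedmann.IsAdmissible G Λ m ℓ a₀ h H) ∧
      ∃! H : C(Set.Icc τ₀ τ₁, ℝ),
        H ∈ U ∧ SemiclassicalFriedmann.IsSolution G Λ m ℓ a₀ H₀ h H := by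
  set Hc := SemiclassicalFriedmann.criticalHubble G with hHc
  have hHc0 : 0 < Hc := (abs_nonneg _).trans_lt hH₀
  -- Half the gap to the critical value, so that `ρ` is the midpoint of `|H₀|` and `Hc`.
  set r := (Hc - |H₀|) / 2 with hr
  have hr0 : 0 < r := by rw [hr]; linarith
  set ρ := |H₀| + r with hρ
  have hρc : ρ < Hc := by rw [hρ, hr]; linarith
  have hρ0 : 0 < ρ := by positivity
  obtain ⟨Mv, Mf, L, hMv, hMf, hL, key⟩ :=
    SemiclassicalFriedmann.exists_constants G Λ m ℓ hm ha₀ hρc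
  have hc : 0 < a₀ * m := mul_pos ha₀ hm
  -- One summand for each smallness condition on `T = D⁻¹`: `T ≤ 1`, regularity of the scale factor,
  -- the mode series and Volterra estimates, invariance of the ball, contraction.
  set D := 1 + 2 * (a₀ * Hc) + 6 * Mv / (a₀ * m) + Mf / r + 2 * L with hD
  have p1 : 0 ≤ a₀ * Hc := by positivity
  have p2 : 0 ≤ 6 * Mv / (a₀ * m) := by positivity
  have p3 : 0 ≤ Mf / r := by positivity
  have hD0 : 0 < D := by positivity
  set T := D⁻¹ with hTdef
  have hT0 : 0 < T := inv_pos.2 hD0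
  have hbd : ∀ x, x ≤ D → x * T ≤ 1 := fun x hx => by
    rw [hTdef, ← div_eq_mul_inv]; exact (div_le_one hD0).2 hx
  have hT1 : T ≤ 1 := by have := hbd 1 (by linarith); linarith
  have hTc : 2 * (a₀ * Hc) * T ≤ 1 := hbd _ (by linarith)
  have hTρ : a₀ * ρ * T ≤ 1 / 2 := by
    have : a₀ * ρ * T ≤ a₀ * Hc * T := by gcongr
    linarith
  have hTv : 6 * Mv * T ^ 2 ≤ a₀ * m := by
    have h1 := hbd (6 * Mv / (a₀ * m)) (by linarith)
    rw [div_mul_eq_mul_div, div_le_one hc] at h1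
    have : 6 * Mv * T ^ 2 ≤ 6 * Mv * T := by
      rw [sq, ← mul_assoc]
      exact mul_le_of_le_one_right (by positivity) hT1
    linarith
  have hTf : Mf * T ≤ r := by
    have h1 := hbd (Mf / r) (by linarith)
    rwa [div_mul_eq_mul_div, div_le_one hr0] at h1
  have hTL : L * T ≤ 1 / 2 := by
    have h1 := hbd (2 * L) (by linarith)
    linarith
  obtain ⟨k1, k2⟩ := key τ₀ T hT0.le hT1 hTρ hTv
  have hlt : τ₀ < τ₀ + T := by linarith
  set U : Set C(Set.Icc τ₀ (τ₀ + T), ℝ) :=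
    Metric.closedBall (ContinuousMap.const _ H₀) r with hU
  have hnorm : ∀ H ∈ U, ‖H‖ ≤ ρ := by
    intro H hH
    have h1 : ‖H - ContinuousMap.const _ H₀‖ ≤ r := by rw [← dist_eq_norm]; exact hH
    refine (ContinuousMap.norm_le _ hρ0.le).2 fun t => ?_
    have h2 := (ContinuousMap.norm_coe_le_norm (H - ContinuousMap.const _ H₀) t).trans h1
    rw [ContinuousMap.sub_apply, ContinuousMap.const_apply, Real.norm_eq_abs] at h2
    have h3 := abs_add_le (H t - H₀) H₀
    rw [sub_add_cancel] at h3
    rw [Real.norm_eq_abs, hρ]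
    linarith
  refine ⟨τ₀ + T, hlt, U, Metric.isClosed_closedBall, fun H hH => ?_, ⟨r, hr0, subset_rfl⟩,
    fun H hH => ⟨fun τ => ?_, fun τ => ?_, fun τ => (k1 H (hnorm H hH)).2.1 τ τ.2,
      (k1 H (hnorm H hH)).2.2.1⟩, ?_⟩
  · refine lt_min ((hnorm H hH).trans_lt (hρc.trans_le ?_)) ((hnorm H hH).trans_lt hρc)
    rw [add_sub_cancel_left, ← mul_inv, ← one_div, le_div_iff₀ (by positivity)]
    nlinarith [mul_nonneg p1 hT0.le]
  · have h1 := (k1 H (hnorm H hH)).1 τ τ.2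
    rw [SemiclassicalFriedmann.redshift, SemiclassicalFriedmann.primitive] at h1
    linarith
  · exact ((ContinuousMap.norm_coe_le_norm H τ).trans (hnorm H hH)).trans_lt hρc
  · exact SemiclassicalFriedmann.existsUnique_picard hT0.le hr0.le H₀
      (fun H => SemiclassicalFriedmann.friedmannIntegrand G Λ m ℓ a₀ τ₀
        (Set.IccExtend hlt.le H)) hU
      (fun H hH => (k1 H (hnorm H hH)).2.2.1) (fun H hH => (k1 H (hnorm H hH)).2.2.2)
      (fun H₁ h₁ H₂ h₂ => k2 H₁ H₂ (hnorm H₁ h₁) (hnorm H₂ h₂)) hTf hTL
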